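/- Let $Q\in C^1([0,\infty))$, $Q\ge 0$, and let $C_1,\dots,C_4,F_0>0$ and $0<\mu_1,\mu_2,\mu_3<1$ be constants such that (Q1) $Q(f)\ge C_1 f^{1+1/\mu_1}$ for $f\ge F_0$; (Q2) $Q(f)\le C_2 f^{1+1/\mu_2}$ for $0\le f\le F_0$; (Q3) $Q(\lambda f)\ge \lambda^{1+1/\mu_3}Q(f)$ for $f\ge 0$, $0\le\lambda\le 1$; (Q4) $Q'$ is differentiable on $(0,\infty)$ with $Q''(f)>0$ for $f>0$, and $Q'(0)=0$; (Q5) $C_3Q''(f)\le Q''(\lambda f)\le C_4Q''(f)$ for all $f>0$ and all $\lambda$ in some neighborhood of $1$ (independent of $f$). Then $Q'$ is strictly increasing from $[0,\infty)$ onto $[0,\infty)$; let $q$ be its inverse, extended by $q(\epsilon)=0$ for $\epsilon<0$. Assume in addition that there is a constant $C>0$ with $Q'(f)\ge C f^{1/\mu_1}$ for all sufficiently large $f$. For $f=f(x,v)$, $x,v\in\mathbb R^2$, let $\rho_f(x)=\int_{\mathbb R^2} f(x,v)\,dv$, $U_f(x)=-\int_{\mathbb R^2}\frac{\rho_f(y)}{|x-y|}\,dy$,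 and $$\mathcal D(f)=\iint Q(f)\,dv\,dx+\frac12\iint |v|^2 f\,dv\,dx+\frac12\int \rho_f U_f\,dx .$$ For $M>0$ let $\mathcal F_M^S$ be the set of all $f\in L^1(\mathbb R^4)$ with $f\ge 0$, $\iint f\,dv\,dx=M$, $\iint Q(f)\,dv\,dx+\frac12\iint|v|^2f\,dv\,dx<\infty$, that are axially symmetric, i.e. $f(Ax,Av)=f(x,v)$ for all $A\in SO(2)$. Let $f_0\in\mathcal F_M^S$ be a minimizer of $\mathcal D$ over $\mathcal F_M^S$, and let $\rho_0=\rho_{f_0}$, $U_0=U_{f_0}$. Then $\rho_0$ (after modification on a null set) and $U_0$ (whose defining integral converges at every point) belong to $C^1(\mathbb R^2)$, and the first derivatives of $U_0$ are Hölder continuous on $\mathbb R^2$. If moreover $q$ is locally Hölder continuous, then $U_0\in C^2(\mathbb R^2)$, and the second derivatives of $U_0$ are Hölder continuous on $\mathbb R^2$. -/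

import Mathlib

open MeasureTheory Filter Topology Set
open scoped NNReal

namespace FlatVlasovPoisson

noncomputable section

/-- The plane `ℝ²` with the Euclidean norm and Lebesgue measure; it carries both the positions `x`
and the velocities `v`. A phase space density is a function of `(x, v) ∈ ℝ² × ℝ²`. -/
abbrev Plane : Type := EuclideanSpace ℝ (Fin 2)

/-- The derivative `Q'` of `Q ∈ C¹([0, ∞))`, one-sided at `0`. -/
def dQ (Q : ℝ → ℝ) : ℝ → ℝ := derivWithin Q (Ici 0)

/-- The second derivative `Q''`, used at points of `(0, ∞)` only. -/
def ddQ (Q : ℝ → ℝ) : ℝ → ℝ := deriv (dQ Q)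

/-- The assumptions on `Q`: the standing ones (`Q ∈ C¹([0, ∞))`, `Q ≥ 0`, positivity of the
constants, exponents in `(0, 1)`), and the conditions (Q1) to (Q5). -/
structure CasimirAssumptions (Q : ℝ → ℝ) (μ₁ μ₂ μ₃ C₁ C₂ C₃ C₄ F₀ : ℝ) : Prop where
  contDiffOn : ContDiffOn ℝ 1 Q (Ici 0)
  nonneg : ∀ f, 0 ≤ f → 0 ≤ Q f
  μ₁_mem : μ₁ ∈ Ioo (0 : ℝ) 1
  μ₂_mem : μ₂ ∈ Ioo (0 : ℝ) 1
  μ₃_mem : μ₃ ∈ Ioo (0 : ℝ) 1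
  C₁_pos : 0 < C₁
  C₂_pos : 0 < C₂
  C₃_pos : 0 < C₃
  C₄_pos : 0 < C₄
  F₀_pos : 0 < F₀
  Q1 : ∀ f, F₀ ≤ f → C₁ * f ^ (1 + 1 / μ₁) ≤ Q f
  Q2 : ∀ f, 0 ≤ f → f ≤ F₀ → Q f ≤ C₂ * f ^ (1 + 1 / μ₂)
  Q3 : ∀ f, 0 ≤ f → ∀ l, 0 ≤ l → l ≤ 1 → l ^ (1 + 1 / μ₃) * Q f ≤ Q (l * f)
  Q4 : (∀ f, 0 < f → DifferentiableAt ℝ (dQ Q) f ∧ 0 < ddQ Q f) ∧ dQ Q 0 = 0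
  Q5 : ∀ᶠ l in 𝓝 (1 : ℝ), ∀ f, 0 < f →
    C₃ * ddQ Q f ≤ ddQ Q (l * f) ∧ ddQ Q (l * f) ≤ C₄ * ddQ Q f

/-- The function `q`: the inverse of `Q' : [0, ∞) → [0, ∞)`, extended by `0` to `(-∞, 0)`. -/
def qInv (Q : ℝ → ℝ) (ε : ℝ) : ℝ :=
  if 0 ≤ ε then Function.invFunOn (dQ Q) (Ici 0) ε else 0

/-- The spatial density `ρ_f(x) = ∫ f(x, v) dv`. -/
def density (f : Plane × Plane → ℝ) (x : Plane) : ℝ := ∫ v, f (x, v)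

/-- The potential `U_ρ(x) = - ∫ ρ(y) / |x - y| dy`. -/
def potential (ρ : Plane → ℝ) (x : Plane) : ℝ := - ∫ y, ρ y / ‖x - y‖

/-- The kinetic energy `½ ∬ |v|² f dv dx`. -/
def kineticEnergy (f : Plane × Plane → ℝ) : ℝ := (1 / 2) * ∫ z, ‖z.2‖ ^ 2 * f z

/-- The potential energy `½ ∫ ρ_f U_f dx`. -/
def potentialEnergy (f : Plane × Plane → ℝ) : ℝ :=
  (1 / 2) * ∫ x, density f x * potential (density f) x

/-- The Casimir functional `∬ Q(f) dv dx`. -/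
def casimir (Q : ℝ → ℝ) (f : Plane × Plane → ℝ) : ℝ := ∫ z, Q (f z)

/-- The energy-Casimir functional `D`. -/
def energyCasimir (Q : ℝ → ℝ) (f : Plane × Plane → ℝ) : ℝ :=
  casimir Q f + kineticEnergy f + potentialEnergy f

/-- Axial symmetry of (the class modulo null sets of) a phase space density:
`f(Ax, Av) = f(x, v)` for all `A ∈ SO(2)`. -/
def IsAxiallySymmetric (f : Plane × Plane → ℝ) : Prop :=
  ∀ A ∈ Matrix.specialOrthogonalGroup (Fin 2) ℝ, ∀ᵐ z : Plane × Plane,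
    f (Matrix.toEuclideanLin A z.1, Matrix.toEuclideanLin A z.2) = f z

/-- The constraint set of `f ∈ L¹(ℝ⁴)` with `f ≥ 0`, `∬ f = M`, and finite kinetic energy and
Casimir functional (both have nonnegative integrands, so finiteness is integrability). -/
def admissible (Q : ℝ → ℝ) (M : ℝ) : Set (Plane × Plane → ℝ) :=
  {f | Integrable f ∧ (∀ᵐ z, 0 ≤ f z) ∧ ∫ z, f z = M ∧
    Integrable (fun z : Plane × Plane => ‖z.2‖ ^ 2 * f z) ∧ Integrable (fun z => Q (f z))}

/-- The axially symmetric elements of the constraint set. -/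
def admissibleSymm (Q : ℝ → ℝ) (M : ℝ) : Set (Plane × Plane → ℝ) :=
  {f | f ∈ admissible Q M ∧ IsAxiallySymmetric f}

/-- (Global) Hölder continuity with some exponent in `(0, 1]`. -/
def IsHolder {X Y : Type*} [PseudoEMetricSpace X] [PseudoEMetricSpace Y] (g : X → Y) : Prop :=
  ∃ C α : ℝ≥0, 0 < α ∧ α ≤ 1 ∧ HolderWith C α g

/-- Local Hölder continuity: every point has a neighbourhood on which the function is Hölder
continuous; exponent and constant may depend on the point. -/
def IsLocallyHolder {X Y : Type*} [PseudoEMetricSpace X] [PseudoEMetricSpace Y] (g : X → Y) :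
    Prop :=
  ∀ x, ∃ s ∈ 𝓝 x, ∃ C α : ℝ≥0, 0 < α ∧ α ≤ 1 ∧ HolderOnWith C α g s

end

end FlatVlasovPoisson

/-!
A minimizer satisfies the Euler-Lagrange equation `f₀ = q(E - |v|² / 2 - U₀)`, so that its density
is a `C¹` function of its own potential, `ρ₀ = 2π P(E - U₀)` with `P' = q`; regularity is then
gained alternately from this relation and from the smoothing by the kernel `1 / |x|`.

*Euler-Lagrange equation.* By (Q1), an admissible `f` is square integrable, which together with the
kinetic energy puts `ρ_f` into `L¹ ∩ L^{3/2}` (`isTame_density`). On such densities the potential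
energy is a finite quadratic form, so the functional can be expanded along bounded perturbations
(`energyCasimir_add_smul`). Moving a little mass from a region where `Q'(f₀) + |v|² / 2 + U₀ > b`
to one where it is `< a < b` would decrease the functional (`false_of_exchange`). These regions are
axially symmetric because `f₀` and `U₀` are, hence the competitor is admissible. Therefore
`Q'(f₀) + |v|² / 2 + U₀` is at least some constant `E`, with equality where `f₀ > 0`, and inverting
`Q'` gives the equation. Integration over `v` in polar coordinates gives the formula for `ρ₀`.

*Boundedness.* The lower bound on `Q'` gives `q(ε) ≤ A(1 + |ε|)`, hence `ρ₀ ≤ C(1 + U₀²)`. Up to a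
bounded term `|U₀|` is the convolution `N` of `ρ₀` with `1 / |x|` restricted to the unit ball. By
the Cauchy-Schwarz inequality `N²` is at most a constant times the convolution of `ρ₀^{3/2} ∈ L¹`
with `|x|^{-5/6}`; a further convolution with `1 / |x|` is bounded, as `5 / 6 + 1 < 2`
(`exists_convolution_le`). Thus `U₀` and `ρ₀` are bounded.

*Regularity of potentials.* The kernel is decomposed dyadically, `1 / |x| = ∑ 2ᵏ κ(2ᵏ x)` over
`k ∈ ℤ`, with a smooth even `κ` supported in an annulus. An `n`-th derivative of the `k`-th term of
`ρ * 1 / |·|` has size `2^{-kα}` for large `k` if `ρ` is approximated to the order `n - 1 + α` by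
polynomials that `Dⁿκ` annihilates: nothing is needed for `n = 0`, Hölder continuity of `ρ` and
oddness of `Dκ` for `n = 1`, Hölder continuity of `Dρ`, evenness of `D²κ` and `∫ D²κ = 0` for
`n = 2`. For `k → -∞` the terms decay because `ρ ∈ L¹`. One more derivative grows only
exponentially in `|k|`, so interpolation makes the sum of the `n`-th derivatives Hölder continuous
for some smaller exponent (`isBddHolder_tsum`). With `ρ₀ = 2π P(E - U₀)` this is applied for
`n = 0, 1, 2` in turn (`regularity_of_eq_comp_potential`).
-/

namespace FlatVlasovPoisson

/-! ### The derivative of the Casimir function and its inverse -/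

section CasimirFunction

variable {Q : ℝ → ℝ} {μ₁ μ₂ μ₃ C₁ C₂ C₃ C₄ F₀ : ℝ}

theorem CasimirAssumptions.continuousOn_dQ (hQ : CasimirAssumptions Q μ₁ μ₂ μ₃ C₁ C₂ C₃ C₄ F₀) :
    ContinuousOn (dQ Q) (Ici 0) :=
  hQ.contDiffOn.continuousOn_derivWithin (uniqueDiffOn_Ici 0) le_rfl

theorem CasimirAssumptions.hasDerivAt (hQ : CasimirAssumptions Q μ₁ μ₂ μ₃ C₁ C₂ C₃ C₄ F₀)
    {f : ℝ} (hf : 0 < f) : HasDerivAt Q (dQ Q f) f := by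
  have h1 := (hQ.contDiffOn.differentiableOn one_ne_zero f hf.le).hasDerivWithinAt
  exact h1.hasDerivAt (Ici_mem_nhds hf)

theorem CasimirAssumptions.strictMonoOn_dQ (hQ : CasimirAssumptions Q μ₁ μ₂ μ₃ C₁ C₂ C₃ C₄ F₀) :
    StrictMonoOn (dQ Q) (Ici 0) := by
  refine strictMonoOn_of_deriv_pos (convex_Ici 0) hQ.continuousOn_dQ fun x hx => ?_
  rw [interior_Ici] at hx
  exact (hQ.Q4.1 x hx).2

theorem CasimirAssumptions.dQ_nonneg (hQ : CasimirAssumptions Q μ₁ μ₂ μ₃ C₁ C₂ C₃ C₄ F₀)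
    {f : ℝ} (hf : 0 ≤ f) : 0 ≤ dQ Q f := by
  rw [← hQ.Q4.2]
  exact hQ.strictMonoOn_dQ.monotoneOn self_mem_Ici hf hf

/-- The mean value theorem for `Q` on `[0, ∞)`. -/
theorem CasimirAssumptions.exists_sub_eq (hQ : CasimirAssumptions Q μ₁ μ₂ μ₃ C₁ C₂ C₃ C₄ F₀)
    {f g : ℝ} (hf : 0 ≤ f) (hfg : f < g) : ∃ c ∈ Ioo f g, Q g - Q f = dQ Q c * (g - f) := by
  obtain ⟨c, hc, h⟩ := exists_hasDerivAt_eq_slope Q (dQ Q) hfg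
    (hQ.contDiffOn.continuousOn.mono fun x hx => hf.trans hx.1)
    (fun x hx => hQ.hasDerivAt (hf.trans_lt hx.1))
  refine ⟨c, hc, ?_⟩
  rw [h, div_mul_cancel₀ _ (sub_pos.2 hfg).ne']

/-- The linear growth of `Q'` that the lower bound by `f ^ (1 / μ₁)`, `μ₁ < 1`, entails. -/
theorem CasimirAssumptions.exists_linear_le_dQ
    (hQ : CasimirAssumptions Q μ₁ μ₂ μ₃ C₁ C₂ C₃ C₄ F₀)
    (hQ' : ∃ C : ℝ, 0 < C ∧ ∀ᶠ f in atTop, C * f ^ (1 / μ₁) ≤ dQ Q f) :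
    ∃ A : ℝ, 0 < A ∧ ∀ f, 0 ≤ f → f ≤ A * (1 + dQ Q f) := by
  obtain ⟨C, hC, h⟩ := hQ'
  obtain ⟨R, hR⟩ := eventually_atTop.1 (h.and (eventually_ge_atTop 1))
  have hR1 : 1 ≤ R := (hR R le_rfl).2
  refine ⟨R + C⁻¹, by positivity, fun f hf => ?_⟩
  have h0 := hQ.dQ_nonneg hf
  have hCi : 0 < C⁻¹ := inv_pos.2 hC
  rcases le_total f R with hfR | hfR
  · nlinarith [mul_nonneg (by positivity : 0 ≤ R + C⁻¹) h0]
  · obtain ⟨h1, h2⟩ := hR f hfR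
    have h3 : f ≤ f ^ (1 / μ₁) := by
      have : (1 : ℝ) ≤ 1 / μ₁ := by
        rw [le_div_iff₀ hQ.μ₁_mem.1]; linarith [hQ.μ₁_mem.2]
      simpa using Real.rpow_le_rpow_of_exponent_le h2 this
    have h4 : f ≤ C⁻¹ * dQ Q f := by
      rw [le_inv_mul_iff₀ hC]
      exact (mul_le_mul_of_nonneg_left h3 hC.le).trans h1
    nlinarith [mul_nonneg (by positivity : 0 ≤ R) h0]

/-- `Q'` continued to the negative half-line by the identity; an increasing bijection of `ℝ`. -/
noncomputable def dQExt (Q : ℝ → ℝ) (f : ℝ) : ℝ := if 0 ≤ f then dQ Q f else f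

theorem CasimirAssumptions.strictMono_dQExt
    (hQ : CasimirAssumptions Q μ₁ μ₂ μ₃ C₁ C₂ C₃ C₄ F₀) : StrictMono (dQExt Q) := by
  intro f g hfg
  unfold dQExt
  split_ifs with h1 h2 h2
  · exact hQ.strictMonoOn_dQ h1 h2 hfg
  · linarith
  · linarith [hQ.dQ_nonneg h2]
  · exact hfg

theorem CasimirAssumptions.surjective_dQExt
    (hQ : CasimirAssumptions Q μ₁ μ₂ μ₃ C₁ C₂ C₃ C₄ F₀)
    (hQ' : ∃ C : ℝ, 0 < C ∧ ∀ᶠ f in atTop, C * f ^ (1 / μ₁) ≤ dQ Q f) :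
    Function.Surjective (dQExt Q) := by
  intro e
  rcases lt_or_ge e 0 with he | he
  · exact ⟨e, by simp [dQExt, not_le.2 he]⟩
  · obtain ⟨A, hA, h⟩ := hQ.exists_linear_le_dQ hQ'
    have hb : 0 ≤ A * (1 + e) := by positivity
    have h1 := h _ hb
    have h2 : e ≤ dQ Q (A * (1 + e)) := by
      have := le_of_mul_le_mul_left h1 hA
      linarith
    obtain ⟨f, hf, hfe⟩ := intermediate_value_Icc hb
      (hQ.continuousOn_dQ.mono fun x hx => hx.1) ⟨by rw [hQ.Q4.2]; exact he, h2⟩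
    exact ⟨f, by simp [dQExt, hf.1, hfe]⟩

/-- The bijection `dQExt Q` as an order isomorphism, whose inverse is therefore continuous. -/
noncomputable def dQIso (hQ : CasimirAssumptions Q μ₁ μ₂ μ₃ C₁ C₂ C₃ C₄ F₀)
    (hQ' : ∃ C : ℝ, 0 < C ∧ ∀ᶠ f in atTop, C * f ^ (1 / μ₁) ≤ dQ Q f) : ℝ ≃o ℝ :=
  StrictMono.orderIsoOfSurjective (dQExt Q) hQ.strictMono_dQExt (hQ.surjective_dQExt hQ')

theorem CasimirAssumptions.qInv_dQ (hQ : CasimirAssumptions Q μ₁ μ₂ μ₃ C₁ C₂ C₃ C₄ F₀)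
    {f : ℝ} (hf : 0 ≤ f) : qInv Q (dQ Q f) = f := by
  rw [qInv, if_pos (hQ.dQ_nonneg hf)]
  exact hQ.strictMonoOn_dQ.injOn.leftInvOn_invFunOn hf

theorem CasimirAssumptions.qInv_of_nonpos (hQ : CasimirAssumptions Q μ₁ μ₂ μ₃ C₁ C₂ C₃ C₄ F₀)
    {e : ℝ} (he : e ≤ 0) : qInv Q e = 0 := by
  rcases he.lt_or_eq with h | rfl
  · simp [qInv, not_le.2 h]
  · conv_lhs => rw [← hQ.Q4.2]
    exact hQ.qInv_dQ le_rfl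

theorem CasimirAssumptions.qInv_eq (hQ : CasimirAssumptions Q μ₁ μ₂ μ₃ C₁ C₂ C₃ C₄ F₀)
    (hQ' : ∃ C : ℝ, 0 < C ∧ ∀ᶠ f in atTop, C * f ^ (1 / μ₁) ≤ dQ Q f) (e : ℝ) :
    qInv Q e = max 0 ((dQIso hQ hQ').symm e) := by
  obtain ⟨f, rfl⟩ := (dQIso hQ hQ').surjective e
  rw [OrderIso.symm_apply_apply]
  change qInv Q (dQExt Q f) = _
  unfold dQExt
  split_ifs with h
  · rw [hQ.qInv_dQ h, max_eq_right h]
  · rw [hQ.qInv_of_nonpos (not_le.1 h).le, max_eq_left (not_le.1 h).le]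

theorem CasimirAssumptions.continuous_qInv (hQ : CasimirAssumptions Q μ₁ μ₂ μ₃ C₁ C₂ C₃ C₄ F₀)
    (hQ' : ∃ C : ℝ, 0 < C ∧ ∀ᶠ f in atTop, C * f ^ (1 / μ₁) ≤ dQ Q f) :
    Continuous (qInv Q) := by
  rw [funext (hQ.qInv_eq hQ')]
  exact continuous_const.max (dQIso hQ hQ').symm.continuous

theorem CasimirAssumptions.qInv_nonneg (hQ : CasimirAssumptions Q μ₁ μ₂ μ₃ C₁ C₂ C₃ C₄ F₀)
    (hQ' : ∃ C : ℝ, 0 < C ∧ ∀ᶠ f in atTop, C * f ^ (1 / μ₁) ≤ dQ Q f) (e : ℝ) :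
    0 ≤ qInv Q e := by
  rw [hQ.qInv_eq hQ']
  exact le_max_left _ _

theorem CasimirAssumptions.exists_qInv_le (hQ : CasimirAssumptions Q μ₁ μ₂ μ₃ C₁ C₂ C₃ C₄ F₀)
    (hQ' : ∃ C : ℝ, 0 < C ∧ ∀ᶠ f in atTop, C * f ^ (1 / μ₁) ≤ dQ Q f) :
    ∃ A : ℝ, 0 < A ∧ ∀ e, qInv Q e ≤ A * (1 + |e|) := by
  obtain ⟨A, hA, h⟩ := hQ.exists_linear_le_dQ hQ'
  refine ⟨A, hA, fun e => ?_⟩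
  rcases le_total e 0 with he | he
  · rw [hQ.qInv_of_nonpos he]; positivity
  · obtain ⟨f, rfl⟩ := (dQIso hQ hQ').surjective e
    change qInv Q (dQExt Q f) ≤ A * (1 + |dQExt Q f|)
    change 0 ≤ dQExt Q f at he
    have hf : 0 ≤ f := by
      by_contra hf
      rw [dQExt, if_neg hf] at he
      exact hf he
    rw [dQExt, if_pos hf, hQ.qInv_dQ hf, abs_of_nonneg (hQ.dQ_nonneg hf)]
    exact h f hf

/-- The primitive `u ↦ ∫₀ᵘ q` of `q`. -/
noncomputable def qPrim (Q : ℝ → ℝ) (u : ℝ) : ℝ := ∫ s in (0 : ℝ)..u, qInv Q s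

theorem CasimirAssumptions.hasDerivAt_qPrim (hQ : CasimirAssumptions Q μ₁ μ₂ μ₃ C₁ C₂ C₃ C₄ F₀)
    (hQ' : ∃ C : ℝ, 0 < C ∧ ∀ᶠ f in atTop, C * f ^ (1 / μ₁) ≤ dQ Q f) (u : ℝ) :
    HasDerivAt (qPrim Q) (qInv Q u) u :=
  (hQ.continuous_qInv hQ').integral_hasStrictDerivAt 0 u |>.hasDerivAt

theorem CasimirAssumptions.qPrim_of_nonpos (hQ : CasimirAssumptions Q μ₁ μ₂ μ₃ C₁ C₂ C₃ C₄ F₀)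
    {u : ℝ} (hu : u ≤ 0) : qPrim Q u = 0 := by
  rw [qPrim]
  refine intervalIntegral.integral_zero_ae (Eventually.of_forall fun s hs => ?_)
  rw [uIoc_of_ge hu] at hs
  exact hQ.qInv_of_nonpos hs.2

theorem CasimirAssumptions.exists_qPrim_le (hQ : CasimirAssumptions Q μ₁ μ₂ μ₃ C₁ C₂ C₃ C₄ F₀)
    (hQ' : ∃ C : ℝ, 0 < C ∧ ∀ᶠ f in atTop, C * f ^ (1 / μ₁) ≤ dQ Q f) :
    ∃ A : ℝ, 0 < A ∧ ∀ u, qPrim Q u ≤ A * (1 + u ^ 2) := by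
  obtain ⟨A, hA, h⟩ := hQ.exists_qInv_le hQ'
  refine ⟨2 * A, by positivity, fun u => ?_⟩
  rcases le_total u 0 with hu | hu
  · rw [hQ.qPrim_of_nonpos hu]; positivity
  have h1 : qPrim Q u ≤ A * (1 + u) * u := by
    have h2 : ∀ s ∈ uIoc 0 u, ‖qInv Q s‖ ≤ A * (1 + u) := by
      intro s hs
      rw [uIoc_of_le hu] at hs
      rw [Real.norm_of_nonneg (hQ.qInv_nonneg hQ' s)]
      refine (h s).trans ?_
      rw [abs_of_pos hs.1]
      exact mul_le_mul_of_nonneg_left (by linarith [hs.2]) hA.le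
    have h3 := intervalIntegral.norm_integral_le_of_norm_le_const h2
    rw [sub_zero, abs_of_nonneg hu] at h3
    exact (le_abs_self _).trans h3
  nlinarith [mul_nonneg hA.le (sq_nonneg (u - 1)), sq_nonneg u]

/-- Integration over the velocity plane in polar coordinates. -/
theorem CasimirAssumptions.integral_qInv (hQ : CasimirAssumptions Q μ₁ μ₂ μ₃ C₁ C₂ C₃ C₄ F₀)
    (hQ' : ∃ C : ℝ, 0 < C ∧ ∀ᶠ f in atTop, C * f ^ (1 / μ₁) ≤ dQ Q f) (u : ℝ) :
    ∫ v : Plane, qInv Q (u - ‖v‖ ^ 2 / 2) = 2 * Real.pi * qPrim Q u := by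
  have key : ∫ y in Ioi (0 : ℝ), y * qInv Q (u - y ^ 2 / 2) = qPrim Q u := by
    have hder : ∀ y ∈ Ici (0 : ℝ), HasDerivAt (fun y : ℝ => - qPrim Q (u - y ^ 2 / 2))
        (y * qInv Q (u - y ^ 2 / 2)) y := by
      intro y _
      have h1 : HasDerivAt (fun y : ℝ => u - y ^ 2 / 2) (-y) y := by
        have := ((hasDerivAt_pow 2 y).div_const 2).const_sub u
        exact this.congr_deriv (by norm_num)
      have := ((hQ.hasDerivAt_qPrim hQ' (u - y ^ 2 / 2)).comp y h1).neg
      exact this.congr_deriv (by ring)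
    have hbig : ∀ᶠ y : ℝ in atTop, u - y ^ 2 / 2 ≤ 0 := by
      filter_upwards [eventually_ge_atTop (|u| + 2)] with y hy
      nlinarith [le_abs_self u, abs_nonneg u]
    have htend : Tendsto (fun y : ℝ => - qPrim Q (u - y ^ 2 / 2)) atTop (𝓝 0) := by
      refine tendsto_const_nhds.congr' ?_
      filter_upwards [hbig] with y hy
      rw [hQ.qPrim_of_nonpos hy, neg_zero]
    have := integral_Ioi_of_hasDerivAt_of_nonneg' hder
      (fun y hy => mul_nonneg (le_of_lt hy) (hQ.qInv_nonneg hQ' _)) htend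
    rw [this]
    simp
  have h1 := integral_fun_norm_addHaar (volume : Measure Plane) (fun y => qInv Q (u - y ^ 2 / 2))
  rw [h1]
  have h2 : Measure.real (volume : Measure Plane) (Metric.ball 0 1) = Real.pi := by
    rw [Measure.real, EuclideanSpace.volume_ball_fin_two]
    simp [Real.pi_nonneg]
  simp only [finrank_euclideanSpace, Fintype.card_fin, Nat.add_one_sub_one, pow_one, smul_eq_mul,
    nsmul_eq_mul, h2]
  rw [key]
  push_cast
  ring

end CasimirFunction

/-! ### Convolution with rescaled kernels -/

section ScaledConv

variable {F : Type*} [NormedAddCommGroup F]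

theorem exists_norm_le_of_hasCompactSupport {Φ : Plane → F} (hΦ : Continuous Φ)
    (hc : HasCompactSupport Φ) : ∃ C, 0 ≤ C ∧ ∀ z, ‖Φ z‖ ≤ C := by
  obtain ⟨C, hC⟩ := hc.exists_bound_of_continuous hΦ
  exact ⟨C, (norm_nonneg _).trans (hC 0), hC⟩

theorem hasCompactSupport_comp_pos_smul {Φ : Plane → F} (hc : HasCompactSupport Φ) {s : ℝ}
    (hs : 0 < s) : HasCompactSupport fun z => Φ (s • z) :=
  hc.comp_homeomorph (Homeomorph.smulOfNeZero s hs.ne')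

variable [NormedSpace ℝ F]

/-- The convolution `∫ ρ(y) Φ(s(x - y)) dy` of `ρ` with the rescaled kernel `Φ(s ·)`. -/
noncomputable def scaledConv (ρ : Plane → ℝ) (Φ : Plane → F) (s : ℝ) (x : Plane) : F :=
  ∫ y, ρ y • Φ (s • (x - y))

theorem integrable_smul_comp_smul_sub {ρ : Plane → ℝ} (hρ : Integrable ρ) {Φ : Plane → F}
    (hΦ : Continuous Φ) (hc : HasCompactSupport Φ) (s : ℝ) (x : Plane) :
    Integrable fun y => ρ y • Φ (s • (x - y)) := by
  obtain ⟨C, hC0, hC⟩ := exists_norm_le_of_hasCompactSupport hΦ hc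
  have hm : Continuous fun y : Plane => Φ (s • (x - y)) := by fun_prop
  refine (hρ.norm.mul_const C).mono (hρ.1.smul hm.aestronglyMeasurable)
    (Eventually.of_forall fun y => ?_)
  rw [norm_smul, norm_mul, norm_norm, Real.norm_of_nonneg hC0]
  exact mul_le_mul_of_nonneg_left (hC _) (norm_nonneg _)

theorem hasFDerivAt_scaledConv {ρ : Plane → ℝ} (hρ : Integrable ρ) {Φ : Plane → F}
    (hΦ : ContDiff ℝ 1 Φ) (hc : HasCompactSupport Φ) (s : ℝ) (x : Plane) :
    HasFDerivAt (scaledConv ρ Φ s) (s • scaledConv ρ (fderiv ℝ Φ) s x) x := by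
  obtain ⟨C, hC0, hC⟩ := exists_norm_le_of_hasCompactSupport
    (hΦ.continuous_fderiv one_ne_zero) (hc.fderiv ℝ)
  have hcont : Continuous (fderiv ℝ Φ) := hΦ.continuous_fderiv one_ne_zero
  have key := hasFDerivAt_integral_of_dominated_of_fderiv_le (μ := (volume : Measure Plane))
    (F := fun x y => ρ y • Φ (s • (x - y)))
    (F' := fun x y => ρ y • (s • fderiv ℝ Φ (s • (x - y)))) (s := univ) (x₀ := x)
    (bound := fun y => ‖ρ y‖ * (|s| * C)) univ_mem
    (Eventually.of_forall fun x =>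
      (integrable_smul_comp_smul_sub hρ hΦ.continuous hc s x).1)
    (integrable_smul_comp_smul_sub hρ hΦ.continuous hc s x)
    (hρ.1.smul (by fun_prop : Continuous fun y : Plane =>
      s • fderiv ℝ Φ (s • (x - y))).aestronglyMeasurable)
    (Eventually.of_forall fun y z _ => ?_) (hρ.norm.mul_const _)
    (Eventually.of_forall fun y z _ => ?_)
  · refine key.congr_fderiv ?_
    rw [scaledConv, ← integral_smul]
    exact integral_congr_ae (Eventually.of_forall fun y => smul_comm _ _ _)
  · rw [norm_smul, norm_smul, Real.norm_eq_abs s]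
    gcongr
    exact hC _
  · have h1 : HasFDerivAt Φ (fderiv ℝ Φ (s • (z - y))) (s • (z - y)) :=
      (hΦ.differentiable one_ne_zero _).hasFDerivAt
    have h2 : HasFDerivAt (fun z : Plane => s • (z - y)) (s • ContinuousLinearMap.id ℝ Plane) z :=
      ((hasFDerivAt_id z).sub_const y).const_smul s
    refine ((h1.comp z h2).const_smul (ρ y)).congr_fderiv ?_
    ext v
    simp

theorem norm_scaledConv_le_of_norm_le {ρ : Plane → ℝ} (hρ : Integrable ρ) {Φ : Plane → F} {C : ℝ}
    (hC : ∀ z, ‖Φ z‖ ≤ C) (s : ℝ) (x : Plane) :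
    ‖scaledConv ρ Φ s x‖ ≤ (∫ y, ‖ρ y‖) * C := by
  rw [scaledConv, ← integral_mul_const]
  refine norm_integral_le_of_norm_le (hρ.norm.mul_const C) (Eventually.of_forall fun y => ?_)
  rw [norm_smul]
  exact mul_le_mul_of_nonneg_left (hC _) (norm_nonneg _)

theorem integral_comp_pos_smul (f : Plane → F) {s : ℝ} (hs : 0 < s) :
    ∫ z, f (s • z) = (s ^ 2)⁻¹ • ∫ z, f z := by
  rw [Measure.integral_comp_smul_of_nonneg volume f s (hR := hs.le)]
  simp

/-- If `ρ` agrees with `p` to the order `β` at `x`, and `Φ(s ·)` annihilates `p`, then the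
convolution of `ρ` with `Φ(s ·)` is of size `s ^ (-β)` relative to the mass `s ^ (-2)` of
`Φ(s ·)`. -/
theorem norm_scaledConv_le_of_approx {ρ p : Plane → ℝ} (hρ : Integrable ρ) (hp : Continuous p)
    {Φ : Plane → F} (hΦ : Continuous Φ) (hc : HasCompactSupport Φ) {s C β : ℝ} (hs : 0 < s)
    (hβ : 0 ≤ β) (x : Plane) (happrox : ∀ᵐ z, |ρ (x - z) - p z| ≤ C * ‖z‖ ^ β)
    (hzero : ∫ z, p z • Φ (s • z) = 0) :
    ‖scaledConv ρ Φ s x‖ ≤ C * (∫ z, ‖z‖ ^ β * ‖Φ z‖) * s ^ (-(2 + β)) := by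
  have hcs : HasCompactSupport fun z => Φ (s • z) := hasCompactSupport_comp_pos_smul hc hs
  have hcont : Continuous fun z : Plane => Φ (s • z) := by fun_prop
  have hβc : Continuous fun z : Plane => ‖z‖ ^ β := by
    refine Continuous.rpow_const continuous_norm fun z => Or.inr hβ
  have h1 : scaledConv ρ Φ s x = ∫ z, ρ (x - z) • Φ (s • z) := by
    rw [scaledConv, ← integral_sub_left_eq_self _ volume x]
    simp
  have hi1 : Integrable fun z => ρ (x - z) • Φ (s • z) := by
    have := (integrable_smul_comp_smul_sub hρ hΦ hc s x).comp_sub_left x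
    simpa using this
  have hi2 : Integrable fun z => p z • Φ (s • z) :=
    (hp.smul hcont).integrable_of_hasCompactSupport hcs.smul_left
  have h2 : scaledConv ρ Φ s x = ∫ z, (ρ (x - z) - p z) • Φ (s • z) := by
    simp_rw [sub_smul]
    rw [integral_sub hi1 hi2, hzero, sub_zero, h1]
  have hi3 : Integrable fun z : Plane => ‖z‖ ^ β * ‖Φ (s • z)‖ :=
    (hβc.mul hcont.norm).integrable_of_hasCompactSupport hcs.norm.mul_left
  have h3 : ‖scaledConv ρ Φ s x‖ ≤ ∫ z, C * (‖z‖ ^ β * ‖Φ (s • z)‖) := by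
    rw [h2]
    refine norm_integral_le_of_norm_le (hi3.const_mul C) ?_
    filter_upwards [happrox] with z hz
    rw [norm_smul, ← mul_assoc]
    exact mul_le_mul_of_nonneg_right hz (norm_nonneg _)
  refine h3.trans_eq ?_
  obtain ⟨G, hG⟩ : ∃ G : Plane → ℝ, G = fun z => ‖z‖ ^ β * ‖Φ z‖ := ⟨_, rfl⟩
  have h4 : ∀ z : Plane, ‖z‖ ^ β * ‖Φ (s • z)‖ = s ^ (-β) * G (s • z) := by
    intro z
    simp only [hG, norm_smul, Real.norm_of_nonneg hs.le]
    rw [Real.mul_rpow hs.le (norm_nonneg z), Real.rpow_neg hs.le]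
    field_simp
  simp_rw [h4, ← hG]
  rw [integral_const_mul, integral_const_mul, integral_comp_pos_smul _ hs, smul_eq_mul, neg_add,
    Real.rpow_add hs, Real.rpow_neg hs.le 2]
  norm_cast
  ring

theorem integral_eq_zero_of_odd {f : Plane → F} (hf : ∀ z, f (-z) = -f z) : ∫ z, f z = 0 := by
  have h : ∫ z, f z = -∫ z, f z := by
    rw [← integral_neg, ← integral_neg_eq_self]
    simp [hf]
  have h2 : (2 : ℝ) • ∫ z, f z = 0 := by
    rw [two_smul]
    nth_rewrite 1 [h]
    exact neg_add_cancel _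
  exact (smul_eq_zero.1 h2).resolve_left two_ne_zero

theorem integral_fderiv_eq_zero [CompleteSpace F] {Φ : Plane → F} (hΦ : ContDiff ℝ 1 Φ)
    (hc : HasCompactSupport Φ) : ∫ z, fderiv ℝ Φ z = 0 := by
  have hcont : Continuous (fderiv ℝ Φ) := hΦ.continuous_fderiv one_ne_zero
  have hint : Integrable (fderiv ℝ Φ) :=
    hcont.integrable_of_hasCompactSupport (hc.fderiv ℝ)
  ext v
  rw [ContinuousLinearMap.integral_apply hint]
  have := integral_smul_fderiv_eq_neg_fderiv_smul_of_integrable (μ := (volume : Measure Plane))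
    (f := fun _ => (1 : ℝ)) (g := Φ) (v := v) (by simp)
    (by simpa using hint.apply_continuousLinearMap v)
    (by simpa using hΦ.continuous.integrable_of_hasCompactSupport hc)
    (fun x _ => differentiableAt_const _) (fun x _ => hΦ.differentiable one_ne_zero x)
  simpa using this

theorem fderiv_neg_of_even {Φ : Plane → F} (h : ∀ z, Φ (-z) = Φ z) (z : Plane) :
    fderiv ℝ Φ (-z) = -fderiv ℝ Φ z := by
  have h1 : (fun z => Φ (-z)) = Φ := funext h
  have h2 := fderiv_comp_smul (𝕜 := ℝ) (f := Φ) (-1) (x := z)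
  simp only [neg_smul, one_smul] at h2
  rw [h1] at h2
  rw [h2, neg_neg]

theorem fderiv_neg_of_odd {Φ : Plane → F} (h : ∀ z, Φ (-z) = -Φ z) (z : Plane) :
    fderiv ℝ Φ (-z) = fderiv ℝ Φ z := by
  have h1 : (fun z => Φ (-z)) = fun z => -Φ z := funext h
  have h2 := fderiv_comp_smul (𝕜 := ℝ) (f := Φ) (-1) (x := z)
  simp only [neg_smul, one_smul] at h2
  rw [h1, fderiv_fun_neg] at h2
  exact (neg_injective h2).symm

end ScaledConv

/-! ### Bounded Hölder continuous functions -/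

section Holder

/-- Boundedness together with global Hölder continuity, with a common constant and an exponent in
`(0, 1]`. -/
def IsBddHolder {X F : Type*} [NormedAddCommGroup X] [NormedAddCommGroup F] (g : X → F) : Prop :=
  ∃ C α : ℝ, 0 ≤ C ∧ 0 < α ∧ α ≤ 1 ∧ (∀ x, ‖g x‖ ≤ C) ∧ ∀ x y, ‖g x - g y‖ ≤ C * ‖x - y‖ ^ α

variable {X F G : Type*} [NormedAddCommGroup X] [NormedAddCommGroup F] [NormedAddCommGroup G]

theorem min_le_rpow_mul_rpow {a b θ : ℝ} (ha : 0 ≤ a) (hb : 0 ≤ b) (hθ : 0 ≤ θ) (hθ1 : θ ≤ 1) :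
    min a b ≤ a ^ (1 - θ) * b ^ θ := by
  have hm : 0 ≤ min a b := le_min ha hb
  rcases hm.eq_or_lt with h | h
  · rw [← h]; positivity
  · calc min a b = min a b ^ (1 - θ) * min a b ^ θ := by
          rw [← Real.rpow_add h]; simp
      _ ≤ a ^ (1 - θ) * b ^ θ := by
          refine mul_le_mul (Real.rpow_le_rpow hm (min_le_left _ _) (by linarith))
            (Real.rpow_le_rpow hm (min_le_right _ _) hθ) (by positivity) (by positivity)

/-- A bounded function that is Hölder continuous for an exponent is so for smaller ones. -/
theorem holder_of_le {g : X → F} {C D α θ : ℝ} (hC : 0 ≤ C) (hD : 0 ≤ D) (hθ : 0 < θ)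
    (hθα : θ ≤ α) (hb : ∀ x, ‖g x‖ ≤ C) (h : ∀ x y, ‖g x - g y‖ ≤ D * ‖x - y‖ ^ α) (x y : X) :
    ‖g x - g y‖ ≤ (2 * C + D) * ‖x - y‖ ^ θ := by
  rcases le_total ‖x - y‖ 1 with h1 | h1
  · calc ‖g x - g y‖ ≤ D * ‖x - y‖ ^ α := h x y
      _ ≤ D * ‖x - y‖ ^ θ := by
        refine mul_le_mul_of_nonneg_left ?_ hD
        exact Real.rpow_le_rpow_of_exponent_ge' (norm_nonneg _) h1 hθ.le hθα
      _ ≤ (2 * C + D) * ‖x - y‖ ^ θ := by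
        gcongr; linarith
  · calc ‖g x - g y‖ ≤ ‖g x‖ + ‖g y‖ := norm_sub_le _ _
      _ ≤ (2 * C + D) * 1 := by linarith [hb x, hb y]
      _ ≤ (2 * C + D) * ‖x - y‖ ^ θ := by
        gcongr
        exact Real.one_le_rpow h1 hθ.le

theorem IsBddHolder.continuous {g : X → F} (hg : IsBddHolder g) : Continuous g := by
  obtain ⟨C, α, hC, hα, hα1, hb, h⟩ := hg
  rw [continuous_iff_continuousAt]
  intro x
  rw [ContinuousAt, tendsto_iff_norm_sub_tendsto_zero]
  have h1 : Tendsto (fun y => C * ‖y - x‖ ^ α) (𝓝 x) (𝓝 0) := by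
    have : Continuous fun y : X => C * ‖y - x‖ ^ α :=
      continuous_const.mul ((continuous_id.sub continuous_const).norm.rpow_const
        fun _ => Or.inr hα.le)
    have := this.tendsto x
    simpa [Real.zero_rpow hα.ne'] using this
  exact squeeze_zero (fun _ => norm_nonneg _) (fun y => h y x) h1

theorem IsBddHolder.neg {g : X → F} (hg : IsBddHolder g) : IsBddHolder fun x => -g x := by
  obtain ⟨C, α, hC, hα, hα1, hb, h⟩ := hg
  refine ⟨C, α, hC, hα, hα1, fun x => by simpa using hb x, fun x y => ?_⟩
  rw [← neg_sub', norm_neg]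
  exact h x y

theorem IsBddHolder.const_smul [NormedSpace ℝ F] {g : X → F} (hg : IsBddHolder g) (c : ℝ) :
    IsBddHolder fun x => c • g x := by
  obtain ⟨C, α, hC, hα, hα1, hb, h⟩ := hg
  refine ⟨|c| * C, α, by positivity, hα, hα1, fun x => ?_, fun x y => ?_⟩
  · rw [norm_smul, Real.norm_eq_abs]
    exact mul_le_mul_of_nonneg_left (hb x) (abs_nonneg c)
  · rw [← smul_sub, norm_smul, Real.norm_eq_abs, mul_assoc]
    exact mul_le_mul_of_nonneg_left (h x y) (abs_nonneg c)

theorem IsBddHolder.smul [NormedSpace ℝ F] {f : X → ℝ} {g : X → F} (hf : IsBddHolder f)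
    (hg : IsBddHolder g) : IsBddHolder fun x => f x • g x := by
  obtain ⟨C, α, hC, hα, hα1, hb, h⟩ := hf
  obtain ⟨D, β, hD, hβ, hβ1, hb', h'⟩ := hg
  have hθ : 0 < min α β := lt_min hα hβ
  have h1 := holder_of_le hC hC hθ (min_le_left _ _) hb h
  have h2 := holder_of_le hD hD hθ (min_le_right _ _) hb' h'
  refine ⟨6 * C * D, min α β, by positivity, hθ, (min_le_left _ _).trans hα1, fun x => ?_,
    fun x y => ?_⟩
  · rw [norm_smul]
    calc ‖f x‖ * ‖g x‖ ≤ C * D := by gcongr; exacts [hb x, hb' x]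
      _ ≤ 6 * C * D := by nlinarith [mul_nonneg hC hD]
  · have e : f x • g x - f y • g y = f x • (g x - g y) + (f x - f y) • g y := by
      rw [smul_sub, sub_smul]; abel
    rw [e]
    calc ‖f x • (g x - g y) + (f x - f y) • g y‖
        ≤ ‖f x‖ * ‖g x - g y‖ + ‖f x - f y‖ * ‖g y‖ := by
          refine (norm_add_le _ _).trans ?_
          rw [norm_smul, norm_smul]
      _ ≤ C * ((2 * D + D) * ‖x - y‖ ^ min α β) + (2 * C + C) * ‖x - y‖ ^ min α β * D := by
          gcongr
          exacts [hb x, h2 x y, h1 x y, hb' y]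
      _ = 6 * C * D * ‖x - y‖ ^ min α β := by ring

theorem IsBddHolder.isHolder {g : X → F} (hg : IsBddHolder g) : IsHolder g := by
  obtain ⟨C, α, hC, hα, hα1, hb, h⟩ := hg
  refine ⟨C.toNNReal, α.toNNReal, Real.toNNReal_pos.2 hα, Real.toNNReal_le_one.2 hα1,
    fun x y => ?_⟩
  rw [edist_eq_enorm_sub, edist_eq_enorm_sub, ← ofReal_norm, ← ofReal_norm,
    Real.coe_toNNReal _ hα.le, ENNReal.ofReal_rpow_of_nonneg (norm_nonneg _) hα.le]
  change _ ≤ ENNReal.ofReal C * _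
  rw [← ENNReal.ofReal_mul hC]
  exact ENNReal.ofReal_le_ofReal (h x y)

end Holder

/-! ### The dyadic decomposition of the kernel `1 / |x|` -/

section DyadicKernel

open scoped ContDiff

/-- A smooth radial cutoff function, `1` on the unit ball and `0` off the ball of radius `2`. -/
noncomputable def cutoff : ContDiffBump (0 : Plane) := ⟨1, 2, one_pos, one_lt_two⟩

/-- The smooth even kernel `κ`, supported in an annulus, whose rescalings `2ᵏ κ(2ᵏ ·)`, `k ∈ ℤ`,
add up to `1 / |·|`. -/
noncomputable def dyadicKernel (z : Plane) : ℝ := (cutoff z - cutoff ((2 : ℝ) • z)) / ‖z‖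

theorem cutoff_eq_one {z : Plane} (hz : ‖z‖ ≤ 1) : cutoff z = 1 :=
  cutoff.one_of_mem_closedBall (by simpa [cutoff] using hz)

theorem cutoff_eq_zero {z : Plane} (hz : 2 ≤ ‖z‖) : cutoff z = 0 :=
  cutoff.zero_of_le_dist (by simpa [cutoff] using hz)

theorem dyadicKernel_neg (z : Plane) : dyadicKernel (-z) = dyadicKernel z := by
  simp [dyadicKernel, cutoff.neg]

theorem contDiff_dyadicKernel : ContDiff ℝ ∞ dyadicKernel := by
  rw [contDiff_iff_contDiffAt]
  intro z
  by_cases hz : z = 0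
  · subst hz
    have h : dyadicKernel =ᶠ[𝓝 0] fun _ => 0 := by
      filter_upwards [Metric.ball_mem_nhds (0 : Plane) (by norm_num : (0 : ℝ) < 1 / 2)] with w hw
      rw [mem_ball_zero_iff] at hw
      rw [dyadicKernel, cutoff_eq_one (by linarith), cutoff_eq_one, sub_self, zero_div]
      rw [norm_smul, Real.norm_of_nonneg zero_le_two]
      linarith
    exact contDiffAt_const.congr_of_eventuallyEq h
  · have h1 : ContDiff ℝ ∞ fun z : Plane => cutoff z - cutoff ((2 : ℝ) • z) :=
      cutoff.contDiff.sub (cutoff.contDiff.comp (contDiff_const_smul _))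
    exact h1.contDiffAt.div (contDiffAt_norm ℝ hz) (norm_ne_zero_iff.2 hz)

theorem hasCompactSupport_dyadicKernel : HasCompactSupport dyadicKernel := by
  refine HasCompactSupport.intro (isCompact_closedBall (0 : Plane) 2) fun z hz => ?_
  rw [mem_closedBall_zero_iff, not_le] at hz
  rw [dyadicKernel, cutoff_eq_zero hz.le, cutoff_eq_zero, sub_self, zero_div]
  rw [norm_smul, Real.norm_of_nonneg zero_le_two]
  linarith

theorem hasSum_int_telescope {φ : ℤ → ℝ} {a b : ℝ} (N : ℕ) (ha : ∀ k : ℤ, k ≤ -N → φ k = a)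
    (hb : ∀ k : ℤ, N ≤ k → φ k = b) : HasSum (fun k => φ k - φ (k + 1)) (a - b) := by
  have hinj : Function.Injective fun n : ℕ => (n : ℤ) - N := fun m n h => by
    simpa using h
  rw [← hinj.hasSum_iff]
  · have h0 : ∀ n ∉ Finset.range (2 * N),
        ((fun k => φ k - φ (k + 1)) ∘ fun n : ℕ => (n : ℤ) - N) n = 0 := by
      intro n hn
      rw [Finset.mem_range, not_lt] at hn
      simp only [Function.comp_apply]
      rw [hb _ (by omega), hb _ (by omega), sub_self]
    suffices h : a - b = ∑ n ∈ Finset.range (2 * N),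
        ((fun k => φ k - φ (k + 1)) ∘ fun n : ℕ => (n : ℤ) - N) n by
      rw [h]
      exact hasSum_sum_of_ne_finset_zero h0
    have := Finset.sum_range_sub' (fun n : ℕ => φ ((n : ℤ) - N)) (2 * N)
    rw [show a - b = φ (((0 : ℕ) : ℤ) - N) - φ (((2 * N : ℕ) : ℤ) - N) by
      rw [ha _ (by simp), hb _ (by push_cast; omega)], ← this]
    refine Finset.sum_congr rfl fun n _ => ?_
    simp only [Function.comp_apply]
    congr 2
    push_cast
    ring
  · intro k hk
    have : k < -N := by
      by_contra h
      exact hk ⟨(k + N).toNat, by simp only; omega⟩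
    rw [ha _ this.le, ha _ (by omega), sub_self]

theorem hasSum_dyadicKernel {z : Plane} (hz : z ≠ 0) :
    HasSum (fun k : ℤ => (2 : ℝ) ^ k * dyadicKernel ((2 : ℝ) ^ k • z)) (1 / ‖z‖) := by
  have hz' : 0 < ‖z‖ := norm_pos_iff.2 hz
  obtain ⟨N, hN⟩ : ∃ N : ℕ, max ‖z‖ (2 / ‖z‖) < 2 ^ N := pow_unbounded_of_one_lt _ one_lt_two
  have hN1 : ‖z‖ < 2 ^ N := (le_max_left _ _).trans_lt hN
  have hN2 : 2 / ‖z‖ < 2 ^ N := (le_max_right _ _).trans_lt hN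
  have hnorm : ∀ k : ℤ, ‖(2 : ℝ) ^ k • z‖ = (2 : ℝ) ^ k * ‖z‖ := fun k => by
    rw [norm_smul, Real.norm_of_nonneg (by positivity)]
  have h := hasSum_int_telescope (φ := fun k : ℤ => cutoff ((2 : ℝ) ^ k • z)) (a := 1) (b := 0) N
    (fun k hk => cutoff_eq_one ?_) (fun k hk => cutoff_eq_zero ?_)
  · rw [sub_zero] at h
    refine (h.div_const ‖z‖).congr_fun fun k => ?_
    rw [dyadicKernel, hnorm, smul_smul, zpow_add_one₀ two_ne_zero, mul_comm (2 : ℝ) ((2 : ℝ) ^ k)]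
    field_simp
  · rw [hnorm]
    calc (2 : ℝ) ^ k * ‖z‖ ≤ (2 : ℝ) ^ (-(N : ℤ)) * 2 ^ N := by
          gcongr
          exact one_le_two
      _ = 1 := by rw [zpow_neg, zpow_natCast]; field_simp
  · rw [hnorm]
    rw [div_lt_iff₀ hz'] at hN2
    refine hN2.le.trans ?_
    gcongr
    rw [← zpow_natCast]
    exact zpow_le_zpow_right₀ one_le_two hk

/-- The weight `2 ^ (-|k|)` that measures the convergence of dyadic series. -/
noncomputable def dyadicWeight (k : ℤ) : ℝ := (2 : ℝ) ^ (-|k|)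

theorem dyadicWeight_pos (k : ℤ) : 0 < dyadicWeight k := by unfold dyadicWeight; positivity

theorem dyadicWeight_le_one (k : ℤ) : dyadicWeight k ≤ 1 :=
  zpow_le_one_of_nonpos₀ one_le_two (by simp)

theorem dyadicWeight_of_nonneg {k : ℤ} (hk : 0 ≤ k) : dyadicWeight k = ((2 : ℝ) ^ k)⁻¹ := by
  rw [dyadicWeight, abs_of_nonneg hk, zpow_neg]

theorem dyadicWeight_of_nonpos {k : ℤ} (hk : k ≤ 0) : dyadicWeight k = (2 : ℝ) ^ k := by
  rw [dyadicWeight, abs_of_nonpos hk, neg_neg]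

theorem summable_dyadicWeight_rpow {a : ℝ} (ha : 0 < a) :
    Summable fun k => dyadicWeight k ^ a := by
  have h1 : Summable fun n : ℕ => ((2 : ℝ) ^ (-a)) ^ n :=
    summable_geometric_of_lt_one (by positivity)
      (Real.rpow_lt_one_of_one_lt_of_neg one_lt_two (by linarith))
  have h2 : ∀ n : ℕ, dyadicWeight n ^ a = ((2 : ℝ) ^ (-a)) ^ n := fun n => by
    rw [dyadicWeight_of_nonneg (by positivity), zpow_natCast, ← Real.rpow_natCast,
      ← Real.rpow_natCast, ← Real.rpow_neg zero_le_two, ← Real.rpow_mul zero_le_two,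
      ← Real.rpow_mul zero_le_two]
    ring_nf
  have h3 : ∀ k, dyadicWeight (-k) = dyadicWeight k := fun k => by simp [dyadicWeight]
  refine Summable.of_nat_of_neg (h1.congr fun n => (h2 n).symm) (h1.congr fun n => ?_)
  simp only [h3, h2]

end DyadicKernel

section DyadicSeries

variable {F : Type*} [NormedAddCommGroup F] [NormedSpace ℝ F]

/-- The size of the terms of a dyadic series: those at fine scales are controlled by the
approximation of `ρ` to the order `n - 1 + α` by functions that the kernel annihilates, those at
coarse scales by the mass of `ρ`. -/
theorem exists_norm_dyadic_le {ρ : Plane → ℝ} (hρ : Integrable ρ) {Φ : Plane → F}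
    (hΦ : Continuous Φ) (hc : HasCompactSupport Φ) (n : ℕ) {α C : ℝ} (hα1 : α ≤ 1)
    (hnα : 0 ≤ (n : ℝ) - 1 + α) (hC : 0 ≤ C)
    (H : ∀ x, ∃ p : Plane → ℝ, Continuous p ∧
      (∀ᵐ z, |ρ (x - z) - p z| ≤ C * ‖z‖ ^ ((n : ℝ) - 1 + α)) ∧
      ∀ s : ℝ, 0 < s → ∫ z, p z • Φ (s • z) = 0) :
    ∃ D, 0 ≤ D ∧ ∀ (k : ℤ) (x : Plane),
      ‖((2 : ℝ) ^ k) ^ (n + 1) • scaledConv ρ Φ ((2 : ℝ) ^ k) x‖ ≤ D * dyadicWeight k ^ α := by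
  obtain ⟨B, hB0, hB⟩ := exists_norm_le_of_hasCompactSupport hΦ hc
  have hI : 0 ≤ ∫ z, ‖z‖ ^ ((n : ℝ) - 1 + α) * ‖Φ z‖ := integral_nonneg fun z => by positivity
  have hJ : 0 ≤ ∫ y, ‖ρ y‖ := integral_nonneg fun z => by positivity
  refine ⟨C * (∫ z, ‖z‖ ^ ((n : ℝ) - 1 + α) * ‖Φ z‖) + (∫ y, ‖ρ y‖) * B, by positivity,
    fun k x => ?_⟩
  have hs : 0 < (2 : ℝ) ^ k := by positivity
  rw [norm_smul, Real.norm_of_nonneg (by positivity), add_mul]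
  rcases le_total 0 k with hk | hk
  · obtain ⟨p, hp, hap, hz⟩ := H x
    have h1 := norm_scaledConv_le_of_approx hρ hp hΦ hc hs hnα x hap (hz _ hs)
    have h2 : ((2 : ℝ) ^ k) ^ (n + 1) * ((2 : ℝ) ^ k) ^ (-(2 + ((n : ℝ) - 1 + α)))
        = dyadicWeight k ^ α := by
      rw [dyadicWeight_of_nonneg hk, Real.inv_rpow hs.le, ← Real.rpow_neg hs.le,
        ← Real.rpow_natCast, ← Real.rpow_add hs]
      congr 1
      push_cast
      ring
    have h3 : ((2 : ℝ) ^ k) ^ (n + 1) * ‖scaledConv ρ Φ ((2 : ℝ) ^ k) x‖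
        ≤ C * (∫ z, ‖z‖ ^ ((n : ℝ) - 1 + α) * ‖Φ z‖) * dyadicWeight k ^ α := by
      rw [← h2]
      refine (mul_le_mul_of_nonneg_left h1 (by positivity)).trans_eq (by ring)
    have h4 : 0 ≤ (∫ y, ‖ρ y‖) * B * dyadicWeight k ^ α := by
      have := dyadicWeight_pos k
      positivity
    linarith
  · have h1 := norm_scaledConv_le_of_norm_le hρ hB ((2 : ℝ) ^ k) x
    have ht := dyadicWeight_pos k
    have ht1 := dyadicWeight_le_one k
    have h2 : ((2 : ℝ) ^ k) ^ (n + 1) ≤ dyadicWeight k ^ α := by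
      rw [← dyadicWeight_of_nonpos hk]
      calc dyadicWeight k ^ (n + 1) ≤ dyadicWeight k ^ 1 :=
            pow_le_pow_of_le_one ht.le ht1 (by omega)
        _ = dyadicWeight k ^ (1 : ℝ) := by simp
        _ ≤ dyadicWeight k ^ α := Real.rpow_le_rpow_of_exponent_ge ht ht1 hα1
    have h3 : ((2 : ℝ) ^ k) ^ (n + 1) * ‖scaledConv ρ Φ ((2 : ℝ) ^ k) x‖
        ≤ dyadicWeight k ^ α * ((∫ y, ‖ρ y‖) * B) :=
      mul_le_mul h2 h1 (norm_nonneg _) (by positivity)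
    have h4 : 0 ≤ C * (∫ z, ‖z‖ ^ ((n : ℝ) - 1 + α) * ‖Φ z‖) * dyadicWeight k ^ α := by
      positivity
    linarith

/-- The crude bound for one derivative more, from the boundedness of `ρ` alone. -/
theorem exists_norm_dyadic_succ_le {ρ : Plane → ℝ} (hρ : Integrable ρ) {B : ℝ} (hB0 : 0 ≤ B)
    (hB : ∀ᵐ x, |ρ x| ≤ B) {Φ : Plane → F} (hΦ : Continuous Φ) (hc : HasCompactSupport Φ)
    {n : ℕ} (hn : n ≤ 2) :
    ∃ D, 0 ≤ D ∧ ∀ (k : ℤ) (x : Plane),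
      ‖((2 : ℝ) ^ k) ^ (n + 2) • scaledConv ρ Φ ((2 : ℝ) ^ k) x‖ ≤ D * (dyadicWeight k ^ 2)⁻¹ := by
  have hx : ∀ x, ∀ᵐ z, |ρ (x - z) - 0| ≤ B * ‖z‖ ^ (((0 : ℕ) : ℝ) - 1 + 1) := fun x => by
    have h : ∀ᵐ z, |ρ (x - z)| ≤ B :=
      (Measure.measurePreserving_sub_left volume x).quasiMeasurePreserving.ae hB
    filter_upwards [h] with z hz
    simpa using hz
  obtain ⟨D, hD0, hD⟩ := exists_norm_dyadic_le hρ hΦ hc 0 le_rfl (by simp) hB0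
    (fun x => ⟨fun _ => 0, continuous_const, hx x, by simp⟩)
  refine ⟨D, hD0, fun k x => ?_⟩
  have ht := dyadicWeight_pos k
  have ht1 := dyadicWeight_le_one k
  have h1 := hD k x
  rw [Real.rpow_one] at h1
  rw [zero_add, pow_one] at h1
  rw [pow_succ, ← smul_smul, norm_smul, Real.norm_of_nonneg (by positivity)]
  have h2 : ((2 : ℝ) ^ k) ^ (n + 1) * dyadicWeight k ≤ (dyadicWeight k ^ 2)⁻¹ := by
    rcases le_total 0 k with hk | hk
    · have e : (2 : ℝ) ^ k = (dyadicWeight k)⁻¹ := by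
        rw [dyadicWeight_of_nonneg hk, inv_inv]
      rw [e, pow_succ, inv_mul_cancel_right₀ ht.ne', ← inv_pow]
      exact pow_le_pow_right₀ ((one_le_inv₀ ht).2 ht1) hn
    · rw [← dyadicWeight_of_nonpos hk]
      calc dyadicWeight k ^ (n + 1) * dyadicWeight k ≤ 1 * 1 :=
            mul_le_mul (pow_le_one₀ ht.le ht1) ht1 ht.le zero_le_one
        _ ≤ (dyadicWeight k ^ 2)⁻¹ := by
            rw [one_mul]
            exact (one_le_inv₀ (by positivity)).2 (pow_le_one₀ ht.le ht1)
  calc ((2 : ℝ) ^ k) ^ (n + 1) * ‖(2 : ℝ) ^ k • scaledConv ρ Φ ((2 : ℝ) ^ k) x‖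
      ≤ ((2 : ℝ) ^ k) ^ (n + 1) * (D * dyadicWeight k) := by gcongr
    _ = D * (((2 : ℝ) ^ k) ^ (n + 1) * dyadicWeight k) := by ring
    _ ≤ D * (dyadicWeight k ^ 2)⁻¹ := by gcongr

/-- Interpolation between the decay of the terms and the growth of their derivatives makes the sum
of a dyadic series Hölder continuous. -/
theorem isBddHolder_tsum [CompleteSpace F] {w : ℤ → Plane → F} {w' : ℤ → Plane → Plane →L[ℝ] F}
    {α D E : ℝ} (hα : 0 < α) (hD0 : 0 ≤ D) (hE0 : 0 ≤ E)
    (hw : ∀ k x, HasFDerivAt (w k) (w' k x) x) (hD : ∀ k x, ‖w k x‖ ≤ D * dyadicWeight k ^ α)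
    (hE : ∀ k x, ‖w' k x‖ ≤ E * (dyadicWeight k ^ 2)⁻¹) :
    IsBddHolder fun x => ∑' k, w k x := by
  -- the exponent for which interpolation leaves the factor `dyadicWeight k ^ (α / 2)`
  obtain ⟨θ, hθ⟩ : ∃ θ, θ = α / (2 * (α + 2)) := ⟨_, rfl⟩
  have hθ0 : 0 < θ := by rw [hθ]; positivity
  have hθ1 : θ ≤ 1 := by rw [hθ, div_le_one (by positivity)]; linarith
  have hθe : α * (1 - θ) + -2 * θ = α / 2 := by rw [hθ]; field_simp; ring
  obtain ⟨K, hK⟩ : ∃ K, K = 2 * D + E := ⟨_, rfl⟩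
  have hK0 : 0 ≤ K := by rw [hK]; positivity
  have hsum : Summable fun k => K * dyadicWeight k ^ (α / 2) :=
    (summable_dyadicWeight_rpow (half_pos hα)).mul_left K
  have hb : ∀ k x, ‖w k x‖ ≤ K * dyadicWeight k ^ (α / 2) := fun k x => by
    refine (hD k x).trans ?_
    have : dyadicWeight k ^ α ≤ dyadicWeight k ^ (α / 2) :=
      Real.rpow_le_rpow_of_exponent_ge (dyadicWeight_pos k) (dyadicWeight_le_one k) (by linarith)
    have h0 := dyadicWeight_pos k
    gcongr
    rw [hK]; linarith
  have hsw : ∀ x, Summable fun k => w k x := fun x => Summable.of_norm_bounded hsum (hb · x)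
  refine ⟨∑' k, K * dyadicWeight k ^ (α / 2), θ, tsum_nonneg fun k => ?_, hθ0, hθ1, fun x => ?_,
    fun x y => ?_⟩
  · have h0 := dyadicWeight_pos k
    positivity
  · exact tsum_of_norm_bounded hsum.hasSum (hb · x)
  · rw [← (hsw x).tsum_sub (hsw y), ← tsum_mul_right]
    refine tsum_of_norm_bounded (hsum.mul_right _).hasSum fun k => ?_
    have ht := dyadicWeight_pos k
    have h1 : ‖w k x - w k y‖ ≤ K * dyadicWeight k ^ α := by
      calc ‖w k x - w k y‖ ≤ ‖w k x‖ + ‖w k y‖ := norm_sub_le _ _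
        _ ≤ 2 * D * dyadicWeight k ^ α := by linarith [hD k x, hD k y]
        _ ≤ K * dyadicWeight k ^ α := by gcongr; rw [hK]; linarith
    have h2 : ‖w k x - w k y‖ ≤ K * ((dyadicWeight k ^ 2)⁻¹ * ‖x - y‖) := by
      calc ‖w k x - w k y‖ ≤ E * (dyadicWeight k ^ 2)⁻¹ * ‖x - y‖ :=
            convex_univ.norm_image_sub_le_of_norm_hasFDerivWithin_le
              (fun z _ => (hw k z).hasFDerivWithinAt) (fun z _ => hE k z) (mem_univ y) (mem_univ x)
        _ ≤ K * (dyadicWeight k ^ 2)⁻¹ * ‖x - y‖ := by gcongr; rw [hK]; linarith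
        _ = _ := by ring
    calc ‖w k x - w k y‖
        ≤ K * min (dyadicWeight k ^ α) ((dyadicWeight k ^ 2)⁻¹ * ‖x - y‖) := by
          rw [mul_min_of_nonneg _ _ hK0]
          exact le_min h1 h2
      _ ≤ K * ((dyadicWeight k ^ α) ^ (1 - θ) * ((dyadicWeight k ^ 2)⁻¹ * ‖x - y‖) ^ θ) := by
          gcongr
          exact min_le_rpow_mul_rpow (by positivity) (by positivity) hθ0.le hθ1
      _ = K * dyadicWeight k ^ (α / 2) * ‖x - y‖ ^ θ := by
          rw [← hθe, Real.rpow_add ht, Real.mul_rpow (by positivity) (norm_nonneg _),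
            Real.rpow_mul ht.le, Real.rpow_mul ht.le]
          have : (dyadicWeight k ^ 2)⁻¹ = dyadicWeight k ^ (-2 : ℝ) := by
            rw [Real.rpow_neg ht.le]; norm_cast
          rw [this]
          ring

end DyadicSeries

/-! ### Regularity of the potential -/

section PotentialRegularity

theorem hasFDerivAt_dyadic {F : Type*} [NormedAddCommGroup F] [NormedSpace ℝ F] {ρ : Plane → ℝ}
    (hρ : Integrable ρ) {Φ : Plane → F} (hΦ : ContDiff ℝ 1 Φ) (hc : HasCompactSupport Φ) (n : ℕ)
    (s : ℝ) (x : Plane) :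
    HasFDerivAt (fun x => s ^ n • scaledConv ρ Φ s x)
      (s ^ (n + 1) • scaledConv ρ (fderiv ℝ Φ) s x) x := by
  refine ((hasFDerivAt_scaledConv hρ hΦ hc s x).const_smul (s ^ n)).congr_fderiv ?_
  rw [smul_smul, pow_succ]

/-- The potential of a bounded integrable density is the sum of a dyadic series. -/
theorem potential_eq_tsum {ρ : Plane → ℝ} (hρ : Integrable ρ) {B : ℝ} (hB0 : 0 ≤ B)
    (hB : ∀ᵐ x, |ρ x| ≤ B) (x : Plane) :
    potential ρ x
      = -∑' k : ℤ, ((2 : ℝ) ^ k) ^ 1 • scaledConv ρ dyadicKernel ((2 : ℝ) ^ k) x := by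
  have hκ : Continuous dyadicKernel := contDiff_dyadicKernel.continuous
  have hκc := hasCompactSupport_dyadicKernel
  have hb : ∀ x, ∀ᵐ z, |(fun y => ‖ρ y‖) (x - z) - 0| ≤ B * ‖z‖ ^ (((0 : ℕ) : ℝ) - 1 + 1) :=
    fun x => by
      have h : ∀ᵐ z, |ρ (x - z)| ≤ B :=
        (Measure.measurePreserving_sub_left volume x).quasiMeasurePreserving.ae hB
      filter_upwards [h] with z hz
      simpa using hz
  obtain ⟨D, hD0, hD⟩ := exists_norm_dyadic_le hρ.norm hκ.norm hκc.norm 0 le_rfl (by simp) hB0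
    (fun x => ⟨fun _ => 0, continuous_const, hb x, by simp⟩)
  have hint : ∀ k : ℤ, Integrable fun y =>
      (2 : ℝ) ^ k • (ρ y • dyadicKernel ((2 : ℝ) ^ k • (x - y))) := fun k =>
    (integrable_smul_comp_smul_sub hρ hκ hκc ((2 : ℝ) ^ k) x).smul ((2 : ℝ) ^ k)
  have hsum : Summable fun k : ℤ =>
      ∫ y, ‖(2 : ℝ) ^ k • (ρ y • dyadicKernel ((2 : ℝ) ^ k • (x - y)))‖ := by
    refine Summable.of_nonneg_of_le (fun k => integral_nonneg fun y => norm_nonneg _) (fun k => ?_)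
      ((summable_dyadicWeight_rpow one_pos).mul_left D)
    refine le_trans (le_of_eq ?_) ((le_abs_self _).trans (hD k x))
    simp_rw [norm_smul, Real.norm_of_nonneg (zpow_pos (two_pos : (0 : ℝ) < 2) k).le]
    rw [integral_const_mul, zero_add, pow_one, smul_eq_mul]
    rfl
  have h1 := (hasSum_integral_of_summable_integral_norm hint hsum).tsum_eq
  rw [potential]
  congr 1
  have h2 : ∀ k : ℤ, ((2 : ℝ) ^ k) ^ 1 • scaledConv ρ dyadicKernel ((2 : ℝ) ^ k) x
      = ∫ y, (2 : ℝ) ^ k • (ρ y • dyadicKernel ((2 : ℝ) ^ k • (x - y))) := fun k => by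
    rw [integral_smul, pow_one, scaledConv]
  simp_rw [h2]
  rw [h1]
  refine integral_congr_ae ?_
  filter_upwards [(measure_eq_zero_iff_ae_notMem.1 (measure_singleton (μ := volume) x))] with y hy
  have hxy : x - y ≠ 0 := sub_ne_zero.2 fun h => hy (by simp [h])
  have h3 := (hasSum_dyadicKernel hxy).mul_left (ρ y)
  rw [mul_one_div] at h3
  rw [← h3.tsum_eq]
  refine tsum_congr fun k => ?_
  simp only [smul_eq_mul]
  ring

theorem isBddHolder_potential {ρ : Plane → ℝ} (hρ : Integrable ρ) {B : ℝ} (hB0 : 0 ≤ B)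
    (hB : ∀ᵐ x, |ρ x| ≤ B) : IsBddHolder (potential ρ) := by
  have hκ : ContDiff ℝ 1 dyadicKernel := contDiff_dyadicKernel.of_le (by simp)
  have hκc := hasCompactSupport_dyadicKernel
  have hb : ∀ x, ∀ᵐ z, |ρ (x - z) - 0| ≤ B * ‖z‖ ^ (((0 : ℕ) : ℝ) - 1 + 1) := fun x => by
    have h : ∀ᵐ z, |ρ (x - z)| ≤ B :=
      (Measure.measurePreserving_sub_left volume x).quasiMeasurePreserving.ae hB
    filter_upwards [h] with z hz
    simpa using hz
  obtain ⟨D, hD0, hD⟩ := exists_norm_dyadic_le hρ hκ.continuous hκc 0 le_rfl (by simp) hB0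
    (fun x => ⟨fun _ => 0, continuous_const, hb x, by simp⟩)
  obtain ⟨E, hE0, hE⟩ := exists_norm_dyadic_succ_le hρ hB0 hB
    (hκ.continuous_fderiv one_ne_zero) (hκc.fderiv ℝ) (n := 0) (by norm_num)
  rw [funext (potential_eq_tsum hρ hB0 hB)]
  exact (isBddHolder_tsum one_pos hD0 hE0
    (fun k x => hasFDerivAt_dyadic hρ hκ hκc 1 _ x) hD hE).neg

/-- The gradient of the dyadic kernel is odd, hence annihilates constants. -/
theorem integral_smul_fderiv_dyadicKernel (c s : ℝ) :
    ∫ z, c • fderiv ℝ dyadicKernel (s • z) = 0 :=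
  integral_eq_zero_of_odd fun z => by
    rw [smul_neg, fderiv_neg_of_even dyadicKernel_neg, smul_neg]

theorem exists_norm_dyadic_fderiv_le {ρ : Plane → ℝ} (hρ : Integrable ρ) {C α : ℝ} (hC : 0 ≤ C)
    (hα : 0 < α) (hα1 : α ≤ 1) (hH : ∀ x y, ‖ρ x - ρ y‖ ≤ C * ‖x - y‖ ^ α) :
    ∃ D, 0 ≤ D ∧ ∀ (k : ℤ) (x : Plane),
      ‖((2 : ℝ) ^ k) ^ 2 • scaledConv ρ (fderiv ℝ dyadicKernel) ((2 : ℝ) ^ k) x‖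
        ≤ D * dyadicWeight k ^ α := by
  have hκ : ContDiff ℝ 1 dyadicKernel := contDiff_dyadicKernel.of_le (by simp)
  refine exists_norm_dyadic_le hρ (hκ.continuous_fderiv one_ne_zero)
    (hasCompactSupport_dyadicKernel.fderiv ℝ) 1 hα1 (by simpa using hα.le) hC
    (fun x => ⟨fun _ => ρ x, continuous_const, Eventually.of_forall fun z => ?_,
      fun s _ => integral_smul_fderiv_dyadicKernel _ s⟩)
  simpa using hH (x - z) x

/-- The potential of a Hölder continuous density is differentiable, and its gradient is the sum of
the differentiated dyadic series. -/
theorem hasFDerivAt_potential {ρ : Plane → ℝ} (hρ : Integrable ρ) (hH : IsBddHolder ρ)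
    (x : Plane) :
    HasFDerivAt (potential ρ) (-∑' k : ℤ,
      ((2 : ℝ) ^ k) ^ 2 • scaledConv ρ (fderiv ℝ dyadicKernel) ((2 : ℝ) ^ k) x) x := by
  obtain ⟨C, α, hC, hα, hα1, hb, hH⟩ := hH
  have hκ : ContDiff ℝ 1 dyadicKernel := contDiff_dyadicKernel.of_le (by simp)
  have hκc := hasCompactSupport_dyadicKernel
  have hB : ∀ᵐ x, |ρ x| ≤ C := Eventually.of_forall hb
  obtain ⟨D, hD0, hD⟩ := exists_norm_dyadic_fderiv_le hρ hC hα hα1 hH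
  have hbx : ∀ x, ∀ᵐ z, |ρ (x - z) - 0| ≤ C * ‖z‖ ^ (((0 : ℕ) : ℝ) - 1 + 1) := fun x => by
    filter_upwards with z
    simpa using hb (x - z)
  obtain ⟨E, hE0, hE⟩ := exists_norm_dyadic_le hρ hκ.continuous hκc 0 le_rfl (by simp) hC
    (fun x => ⟨fun _ => 0, continuous_const, hbx x, by simp⟩)
  rw [funext (potential_eq_tsum hρ hC hB)]
  refine (hasFDerivAt_tsum ((summable_dyadicWeight_rpow hα).mul_left D)
    (fun k x => hasFDerivAt_dyadic hρ hκ hκc 1 _ x) hD (x₀ := x) ?_ x).neg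
  exact Summable.of_norm_bounded ((summable_dyadicWeight_rpow one_pos).mul_left E) (hE · x)

theorem isBddHolder_fderiv_potential {ρ : Plane → ℝ} (hρ : Integrable ρ) (hH : IsBddHolder ρ) :
    IsBddHolder (fderiv ℝ (potential ρ)) := by
  rw [funext fun x => (hasFDerivAt_potential hρ hH x).fderiv]
  obtain ⟨C, α, hC, hα, hα1, hb, hH⟩ := hH
  have hκ : ContDiff ℝ 2 dyadicKernel := contDiff_dyadicKernel.of_le (by norm_cast)
  have hκ1 : ContDiff ℝ 1 (fderiv ℝ dyadicKernel) := hκ.fderiv_right (by norm_num)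
  have hκc := (hasCompactSupport_dyadicKernel).fderiv ℝ
  obtain ⟨D, hD0, hD⟩ := exists_norm_dyadic_fderiv_le hρ hC hα hα1 hH
  obtain ⟨E, hE0, hE⟩ := exists_norm_dyadic_succ_le hρ hC (Eventually.of_forall hb)
    (hκ1.continuous_fderiv one_ne_zero) (hκc.fderiv ℝ) (n := 1) (by norm_num)
  exact (isBddHolder_tsum hα hD0 hE0
    (fun k x => hasFDerivAt_dyadic hρ hκ1 hκc 2 _ x) hD hE).neg

/-- An even kernel of integral zero annihilates affine functions. -/
theorem integral_affine_smul_eq_zero {F : Type*} [NormedAddCommGroup F] [NormedSpace ℝ F]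
    {Ψ : Plane → F} (hΨ : Continuous Ψ) (hc : HasCompactSupport Ψ) (heven : ∀ z, Ψ (-z) = Ψ z)
    (hzero : ∫ z, Ψ z = 0) (c : ℝ) (L : Plane →L[ℝ] ℝ) {s : ℝ} (hs : 0 < s) :
    ∫ z, (c - L z) • Ψ (s • z) = 0 := by
  have hcont : Continuous fun z : Plane => Ψ (s • z) := by fun_prop
  have hcs := hasCompactSupport_comp_pos_smul hc hs
  have h1 : Integrable fun z => c • Ψ (s • z) :=
    (hcont.integrable_of_hasCompactSupport hcs).smul c
  have h2 : Integrable fun z => L z • Ψ (s • z) :=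
    (L.continuous.smul hcont).integrable_of_hasCompactSupport hcs.smul_left
  have h3 : ∫ z, L z • Ψ (s • z) = 0 := integral_eq_zero_of_odd fun z => by
    rw [smul_neg, heven, map_neg, neg_smul]
  simp_rw [sub_smul]
  rw [integral_sub h1 h2, integral_smul, integral_comp_pos_smul Ψ hs, hzero, h3]
  simp

/-- Taylor's formula of first order with a Hölder remainder. -/
theorem abs_sub_sub_fderiv_le {ρ : Plane → ℝ} (hd : Differentiable ℝ ρ) {C α : ℝ} (hC : 0 ≤ C)
    (hα : 0 < α)
    (hH : ∀ x y, ‖fderiv ℝ ρ x - fderiv ℝ ρ y‖ ≤ C * ‖x - y‖ ^ α) (x z : Plane) :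
    |ρ (x - z) - (ρ x - fderiv ℝ ρ x z)| ≤ C * ‖z‖ ^ (1 + α) := by
  have h := (convex_closedBall x ‖z‖).norm_image_sub_le_of_norm_hasFDerivWithin_le'
    (f := ρ) (φ := fderiv ℝ ρ x) (C := C * ‖z‖ ^ α) (x := x) (y := x - z)
    (fun y _ => (hd y).hasFDerivAt.hasFDerivWithinAt)
    (fun y hy => (hH y x).trans ?_) (by simp) (by simp)
  · have e : ρ (x - z) - (ρ x - fderiv ℝ ρ x z)
        = ρ (x - z) - ρ x - fderiv ℝ ρ x (x - z - x) := by
      rw [sub_sub_cancel_left, map_neg]; ring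
    rw [e, Real.rpow_add' (norm_nonneg _) (by positivity), Real.rpow_one, mul_comm ‖z‖, ← mul_assoc]
    simpa using h
  · rw [mem_closedBall_iff_norm] at hy
    gcongr

theorem exists_norm_dyadic_fderiv_fderiv_le {ρ : Plane → ℝ} (hρ : Integrable ρ)
    (hd : Differentiable ℝ ρ) {C α : ℝ} (hC : 0 ≤ C) (hα : 0 < α) (hα1 : α ≤ 1)
    (hH : ∀ x y, ‖fderiv ℝ ρ x - fderiv ℝ ρ y‖ ≤ C * ‖x - y‖ ^ α) :
    ∃ D, 0 ≤ D ∧ ∀ (k : ℤ) (x : Plane),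
      ‖((2 : ℝ) ^ k) ^ 3 • scaledConv ρ (fderiv ℝ (fderiv ℝ dyadicKernel)) ((2 : ℝ) ^ k) x‖
        ≤ D * dyadicWeight k ^ α := by
  have hκ : ContDiff ℝ 2 dyadicKernel := contDiff_dyadicKernel.of_le (by norm_cast)
  have hκ1 : ContDiff ℝ 1 (fderiv ℝ dyadicKernel) := hκ.fderiv_right (by norm_num)
  have hκc := (hasCompactSupport_dyadicKernel).fderiv ℝ
  refine exists_norm_dyadic_le hρ (hκ1.continuous_fderiv one_ne_zero)
    (hκc.fderiv ℝ) 2 hα1 (by norm_num; linarith) hC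
    (fun x => ⟨fun z => ρ x - fderiv ℝ ρ x z, by fun_prop, Eventually.of_forall fun z => ?_,
      fun s hs => integral_affine_smul_eq_zero (hκ1.continuous_fderiv one_ne_zero)
        (hκc.fderiv ℝ) (fderiv_neg_of_odd (fderiv_neg_of_even dyadicKernel_neg))
        (integral_fderiv_eq_zero hκ1 hκc) _ _ hs⟩)
  have e : ((2 : ℕ) : ℝ) - 1 + α = 1 + α := by norm_num
  rw [e]
  exact abs_sub_sub_fderiv_le hd hC hα hH x z

theorem hasFDerivAt_fderiv_potential {ρ : Plane → ℝ} (hρ : Integrable ρ) (hH : IsBddHolder ρ)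
    (hd : Differentiable ℝ ρ) (hH' : IsBddHolder (fderiv ℝ ρ)) (x : Plane) :
    HasFDerivAt (fderiv ℝ (potential ρ)) (-∑' k : ℤ, ((2 : ℝ) ^ k) ^ 3 •
      scaledConv ρ (fderiv ℝ (fderiv ℝ dyadicKernel)) ((2 : ℝ) ^ k) x) x := by
  rw [funext fun x => (hasFDerivAt_potential hρ hH x).fderiv]
  obtain ⟨C, α, hC, hα, hα1, -, hH⟩ := hH
  obtain ⟨C', β, hC', hβ, hβ1, -, hH'⟩ := hH'
  have hκ : ContDiff ℝ 2 dyadicKernel := contDiff_dyadicKernel.of_le (by norm_cast)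
  have hκ1 : ContDiff ℝ 1 (fderiv ℝ dyadicKernel) := hκ.fderiv_right (by norm_num)
  have hκc := (hasCompactSupport_dyadicKernel).fderiv ℝ
  obtain ⟨E, hE0, hE⟩ := exists_norm_dyadic_fderiv_le hρ hC hα hα1 hH
  obtain ⟨D, hD0, hD⟩ := exists_norm_dyadic_fderiv_fderiv_le hρ hd hC' hβ hβ1 hH'
  refine (hasFDerivAt_tsum ((summable_dyadicWeight_rpow hβ).mul_left D)
    (fun k x => hasFDerivAt_dyadic hρ hκ1 hκc 2 _ x) hD (x₀ := x) ?_ x).neg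
  exact Summable.of_norm_bounded ((summable_dyadicWeight_rpow hα).mul_left E) (hE · x)

theorem isBddHolder_fderiv_fderiv_potential {ρ : Plane → ℝ} (hρ : Integrable ρ)
    (hH : IsBddHolder ρ) (hd : Differentiable ℝ ρ) (hH' : IsBddHolder (fderiv ℝ ρ)) :
    IsBddHolder (fderiv ℝ (fderiv ℝ (potential ρ))) := by
  rw [funext fun x => (hasFDerivAt_fderiv_potential hρ hH hd hH' x).fderiv]
  obtain ⟨B, -, hB, -, -, hb, -⟩ := hH
  obtain ⟨C, α, hC, hα, hα1, -, hH⟩ := hH'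
  have hκ : ContDiff ℝ 3 dyadicKernel := contDiff_dyadicKernel.of_le (by norm_cast)
  have hκ1 : ContDiff ℝ 2 (fderiv ℝ dyadicKernel) := hκ.fderiv_right (by norm_num)
  have hκ2 : ContDiff ℝ 1 (fderiv ℝ (fderiv ℝ dyadicKernel)) := hκ1.fderiv_right (by norm_num)
  have hκc := ((hasCompactSupport_dyadicKernel).fderiv ℝ).fderiv ℝ
  obtain ⟨D, hD0, hD⟩ := exists_norm_dyadic_fderiv_fderiv_le hρ hd hC hα hα1 hH
  obtain ⟨E, hE0, hE⟩ := exists_norm_dyadic_succ_le hρ hB (Eventually.of_forall hb)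
    (hκ2.continuous_fderiv one_ne_zero) (hκc.fderiv ℝ) (n := 2) le_rfl
  exact (isBddHolder_tsum hα hD0 hE0
    (fun k x => hasFDerivAt_dyadic hρ hκ2 hκc 3 _ x) hD hE).neg

end PotentialRegularity

/-! ### Locally Hölder continuous functions -/

section LocallyHolder

theorem IsLocallyHolder.continuous {g : ℝ → ℝ} (hg : IsLocallyHolder g) : Continuous g := by
  rw [continuous_iff_continuousAt]
  intro x
  obtain ⟨s, hs, C, α, hα, -, h⟩ := hg x
  exact (h.continuousOn hα).continuousAt hs

/-- By compactness, a locally Hölder continuous function is Hölder continuous on bounded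
intervals, with a single exponent. -/
theorem IsLocallyHolder.exists_holder_on_Icc {g : ℝ → ℝ} (hg : IsLocallyHolder g) {R : ℝ}
    (hR : 0 ≤ R) :
    ∃ C α : ℝ, 0 ≤ C ∧ 0 < α ∧ α ≤ 1 ∧ (∀ a ∈ Icc (-R) R, |g a| ≤ C) ∧
      ∀ a ∈ Icc (-R) R, ∀ b ∈ Icc (-R) R, |g a - g b| ≤ C * |a - b| ^ α := by
  have hgc := hg.continuous
  choose s hs C α hα hα1 hH using hg
  obtain ⟨t, -, ht⟩ := (isCompact_Icc (a := -R) (b := R)).elim_nhds_subcover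
    (fun x => interior (s x)) (fun x _ => interior_mem_nhds.2 (hs x))
  have h0 : (0 : ℝ) ∈ Icc (-R) R := ⟨by linarith, hR⟩
  have htne : t.Nonempty := by
    obtain ⟨x, hx, -⟩ := mem_iUnion₂.1 (ht h0)
    exact ⟨x, hx⟩
  obtain ⟨x₀, hx₀, hmin⟩ := t.exists_min_image α htne
  obtain ⟨δ, hδ, hleb⟩ := lebesgue_number_lemma_of_metric (isCompact_Icc (a := -R) (b := R))
    (c := fun x : t => interior (s x)) (fun x => isOpen_interior) (fun y hy => by
      obtain ⟨x, hx, hxy⟩ := mem_iUnion₂.1 (ht hy)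
      exact mem_iUnion.2 ⟨⟨x, hx⟩, hxy⟩)
  obtain ⟨B, hB⟩ := (isCompact_Icc (a := -R) (b := R)).exists_bound_of_continuousOn hgc.continuousOn
  have hB0 : 0 ≤ B := (norm_nonneg _).trans (hB 0 h0)
  obtain ⟨A, hA⟩ : ∃ A : ℝ, A = ∑ x ∈ t, (C x : ℝ) := ⟨_, rfl⟩
  have hA0 : 0 ≤ A := by rw [hA]; exact Finset.sum_nonneg fun _ _ => NNReal.coe_nonneg _
  have ha0 : (0 : ℝ) < α x₀ := by exact_mod_cast hα x₀
  have ha1 : (α x₀ : ℝ) ≤ 1 := by exact_mod_cast hα1 x₀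
  obtain ⟨η, hη⟩ : ∃ η, η = min δ 1 := ⟨_, rfl⟩
  have hη0 : 0 < η := by rw [hη]; exact lt_min hδ one_pos
  have hηp : 0 < η ^ (α x₀ : ℝ) := by positivity
  refine ⟨B + A + 2 * B / η ^ (α x₀ : ℝ), α x₀, by positivity, ha0, ha1, fun a ha => ?_,
    fun a ha b hb => ?_⟩
  · have : 0 ≤ A + 2 * B / η ^ (α x₀ : ℝ) := by positivity
    have := hB a ha
    rw [Real.norm_eq_abs] at this
    linarith
  have hpow : 0 ≤ |a - b| ^ (α x₀ : ℝ) := by positivity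
  rcases lt_or_ge |a - b| η with h | h
  · obtain ⟨⟨x, hx⟩, hxs⟩ := hleb a ha
    have hab : |a - b| < δ := h.trans_le (by rw [hη]; exact min_le_left _ _)
    have hab1 : |a - b| ≤ 1 := h.le.trans (by rw [hη]; exact min_le_right _ _)
    have has : a ∈ s x := interior_subset (hxs (Metric.mem_ball_self hδ))
    have hbs : b ∈ s x := interior_subset (hxs (by
      rw [Metric.mem_ball, dist_comm, Real.dist_eq]; exact hab))
    have h1 := (hH x).dist_le has hbs
    rw [Real.dist_eq, Real.dist_eq] at h1
    have hCx : (C x : ℝ) ≤ A := by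
      rw [hA]
      exact Finset.single_le_sum (f := fun x => (C x : ℝ)) (fun _ _ => NNReal.coe_nonneg _) hx
    have h2 : |a - b| ^ (α x : ℝ) ≤ |a - b| ^ (α x₀ : ℝ) :=
      Real.rpow_le_rpow_of_exponent_ge' (abs_nonneg _) hab1 ha0.le (by exact_mod_cast hmin x hx)
    have hD : A ≤ B + A + 2 * B / η ^ (α x₀ : ℝ) := by
      have : 0 ≤ 2 * B / η ^ (α x₀ : ℝ) := by positivity
      linarith
    calc |g a - g b| ≤ C x * |a - b| ^ (α x : ℝ) := h1
      _ ≤ A * |a - b| ^ (α x₀ : ℝ) := by gcongr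
      _ ≤ _ := by gcongr
  · have h1 : |g a - g b| ≤ 2 * B := by
      have h2 := hB a ha
      have h3 := hB b hb
      rw [Real.norm_eq_abs] at h2 h3
      exact (abs_sub _ _).trans (by linarith)
    have h2 : η ^ (α x₀ : ℝ) ≤ |a - b| ^ (α x₀ : ℝ) := by gcongr
    calc |g a - g b| ≤ 2 * B / η ^ (α x₀ : ℝ) * η ^ (α x₀ : ℝ) := by
          rw [div_mul_cancel₀ _ hηp.ne']; exact h1
      _ ≤ (B + A + 2 * B / η ^ (α x₀ : ℝ)) * |a - b| ^ (α x₀ : ℝ) := by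
          gcongr
          linarith

theorem IsLocallyHolder.comp_isBddHolder {X : Type*} [NormedAddCommGroup X] {g : ℝ → ℝ}
    (hg : IsLocallyHolder g) {h : X → ℝ} (hh : IsBddHolder h) : IsBddHolder fun x => g (h x) := by
  obtain ⟨R, β, hR, hβ, hβ1, hb, hH⟩ := hh
  obtain ⟨C, α, hC, hα, hα1, hCb, hCH⟩ := hg.exists_holder_on_Icc hR
  have hm : ∀ x, h x ∈ Icc (-R) R := fun x => abs_le.1 (hb x)
  refine ⟨max C (C * R ^ α), α * β, le_max_of_le_left hC, by positivity,
    mul_le_one₀ hα1 hβ.le hβ1, fun x => (hCb _ (hm x)).trans (le_max_left _ _), fun x y => ?_⟩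
  calc |g (h x) - g (h y)| ≤ C * |h x - h y| ^ α := hCH _ (hm x) _ (hm y)
    _ ≤ C * (R * ‖x - y‖ ^ β) ^ α := by
        gcongr
        exact hH x y
    _ = C * R ^ α * ‖x - y‖ ^ (α * β) := by
        rw [Real.mul_rpow hR (by positivity), ← Real.rpow_mul (norm_nonneg _), mul_comm β α]
        ring
    _ ≤ max C (C * R ^ α) * ‖x - y‖ ^ (α * β) := by
        gcongr
        exact le_max_right _ _

theorem isLocallyHolder_of_contDiff {g : ℝ → ℝ} (hg : ContDiff ℝ 1 g) : IsLocallyHolder g := by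
  intro x
  obtain ⟨K, s, hs, h⟩ := hg.locallyLipschitz x
  exact ⟨s, hs, K, 1, one_pos, le_rfl, holderOnWith_one.2 h⟩

theorem IsBddHolder.const_sub {X : Type*} [NormedAddCommGroup X] {h : X → ℝ}
    (hh : IsBddHolder h) (E : ℝ) : IsBddHolder fun x => E - h x := by
  obtain ⟨C, α, hC, hα, hα1, hb, hH⟩ := hh
  refine ⟨|E| + C, α, by positivity, hα, hα1, fun x => ?_, fun x y => ?_⟩
  · exact (abs_sub _ _).trans (by gcongr; exact hb x)
  · rw [sub_sub_sub_cancel_left, norm_sub_rev]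
    refine (hH x y).trans ?_
    gcongr
    linarith [abs_nonneg E]

end LocallyHolder

/-! ### Bootstrapping from a bounded density -/

section Bootstrap

/-- The regularity of a bounded density that is a `C¹` function of its own potential. -/
theorem regularity_of_eq_comp_potential {ρ : Plane → ℝ} (hρ : Integrable ρ) {B : ℝ}
    (hB0 : 0 ≤ B) (hB : ∀ᵐ x, |ρ x| ≤ B) {g q : ℝ → ℝ} (hg : ∀ u, HasDerivAt g (q u) u)
    (hq : Continuous q) (c E : ℝ) (hρg : ρ =ᵐ[volume] fun x => c * g (E - potential ρ x)) :
    ContDiff ℝ 1 (fun x => c * g (E - potential ρ x)) ∧ ContDiff ℝ 1 (potential ρ) ∧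
      IsHolder (fderiv ℝ (potential ρ)) ∧
      (IsLocallyHolder q → ContDiff ℝ 2 (potential ρ) ∧
        IsHolder (fderiv ℝ (fderiv ℝ (potential ρ)))) := by
  obtain ⟨U, hU⟩ : ∃ U, U = potential ρ := ⟨_, rfl⟩
  obtain ⟨σ, hσ⟩ : ∃ σ : Plane → ℝ, σ = fun x => c * g (E - U x) := ⟨_, rfl⟩
  have hgc : ContDiff ℝ 1 g := by
    rw [contDiff_one_iff_deriv]
    refine ⟨fun u => (hg u).differentiableAt, ?_⟩
    rwa [funext fun u => (hg u).deriv]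
  rw [← hU] at hρg ⊢
  rw [← hσ] at hρg ⊢
  have hσU : U = potential σ := by
    rw [hU]
    funext x
    unfold potential
    congr 1
    refine integral_congr_ae ?_
    filter_upwards [hρg] with y hy
    rw [hy]
  have hσi : Integrable σ := hρ.congr hρg
  have hU0 : IsBddHolder U := by rw [hU]; exact isBddHolder_potential hρ hB0 hB
  have hσ0 : IsBddHolder σ := by
    rw [hσ]
    exact ((isLocallyHolder_of_contDiff hgc).comp_isBddHolder (hU0.const_sub E)).const_smul c
  have hU1 : IsBddHolder (fderiv ℝ U) := by
    rw [hσU]; exact isBddHolder_fderiv_potential hσi hσ0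
  have hUd : Differentiable ℝ U := fun x => by
    rw [hσU]; exact (hasFDerivAt_potential hσi hσ0 x).differentiableAt
  have hUC : ContDiff ℝ 1 U := contDiff_one_iff_fderiv.2 ⟨hUd, hU1.continuous⟩
  have hσC : ContDiff ℝ 1 σ := by
    rw [hσ]
    exact contDiff_const.mul (hgc.comp (contDiff_const.sub hUC))
  refine ⟨hσC, hUC, hU1.isHolder, fun hqH => ?_⟩
  have hσ' : ∀ x, fderiv ℝ σ x = (-c) • (q (E - U x) • fderiv ℝ U x) := by
    intro x
    have h1 : HasFDerivAt (fun x => E - U x) (-fderiv ℝ U x) x :=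
      (hUd x).hasFDerivAt.const_sub E
    have h2 := ((hg (E - U x)).comp_hasFDerivAt x h1).const_mul c
    rw [hσ]
    refine h2.fderiv.trans ?_
    rw [smul_neg, smul_neg, neg_smul]
  have hσ1 : IsBddHolder (fderiv ℝ σ) := by
    rw [funext hσ']
    exact ((hqH.comp_isBddHolder (hU0.const_sub E)).smul hU1).const_smul (-c)
  have hσd : Differentiable ℝ σ := hσC.differentiable one_ne_zero
  have hU2 : IsBddHolder (fderiv ℝ (fderiv ℝ U)) := by
    rw [hσU]; exact isBddHolder_fderiv_fderiv_potential hσi hσ0 hσd hσ1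
  have hUd2 : Differentiable ℝ (fderiv ℝ U) := fun x => by
    rw [hσU]; exact (hasFDerivAt_fderiv_potential hσi hσ0 hσd hσ1 x).differentiableAt
  refine ⟨?_, hU2.isHolder⟩
  have : ContDiff ℝ (1 + 1) U := contDiff_succ_iff_fderiv.2
    ⟨hUd, by simp, contDiff_one_iff_fderiv.2 ⟨hUd2, hU2.continuous⟩⟩
  exact this

end Bootstrap

/-! ### Densities in `L¹ ∩ L^{3/2}` and their interaction energy -/

section NearKernel

/-- The singular part of the kernel `1 / |·|`, supported in the unit ball. -/
noncomputable def nearKernel (z : Plane) : ℝ := if ‖z‖ ≤ 1 then 1 / ‖z‖ else 0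

theorem nearKernel_nonneg (z : Plane) : 0 ≤ nearKernel z := by
  unfold nearKernel; split_ifs <;> positivity

theorem nearKernel_neg (z : Plane) : nearKernel (-z) = nearKernel z := by
  simp [nearKernel]

theorem measurable_nearKernel : Measurable nearKernel :=
  Measurable.ite (measurableSet_le measurable_norm measurable_const)
    (measurable_const.div measurable_norm) measurable_const

theorem one_div_norm_le (z : Plane) : 1 / ‖z‖ ≤ nearKernel z + 1 := by
  unfold nearKernel
  split_ifs with h
  · linarith
  · rw [zero_add, div_le_one (by linarith)]
    linarith

theorem integrable_nearKernel_rpow {s : ℝ} (hs0 : 0 < s) (hs : s < 2) :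
    Integrable fun z : Plane => nearKernel z ^ s := by
  have h1 : IntegrableOn (fun y : ℝ => y ^ (Module.finrank ℝ Plane - 1) •
      ((if y ≤ 1 then 1 / y else 0) ^ s : ℝ)) (Ioi 0) := by
    simp only [finrank_euclideanSpace, Fintype.card_fin, Nat.add_one_sub_one, pow_one, smul_eq_mul]
    have h2 : IntegrableOn (fun r : ℝ => r ^ (1 - s)) (Ioc 0 1) := by
      have := intervalIntegral.intervalIntegrable_rpow' (a := 0) (b := 1) (r := 1 - s)
        (by linarith)
      rwa [intervalIntegrable_iff_integrableOn_Ioc_of_le zero_le_one] at this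
    have h3 := h2.integrable_indicator measurableSet_Ioc
    refine h3.integrableOn.congr_fun (fun r hr => ?_) measurableSet_Ioi
    rw [mem_Ioi] at hr
    by_cases h : r ≤ 1
    · rw [indicator_of_mem (show r ∈ Ioc (0 : ℝ) 1 from ⟨hr, h⟩), if_pos h, one_div,
        Real.inv_rpow hr.le, Real.rpow_sub hr, Real.rpow_one, div_eq_mul_inv]
    · rw [indicator_of_notMem fun h' : r ∈ Ioc (0 : ℝ) 1 => h h'.2, if_neg h,
        Real.zero_rpow hs0.ne', mul_zero]
  exact (integrable_fun_norm_addHaar (volume : Measure Plane)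
    (f := fun r : ℝ => ((if r ≤ 1 then 1 / r else 0) ^ s : ℝ))).2 h1

end NearKernel

section InteractionEnergy

/-- Densities in `L¹ ∩ L^{3/2}`, for which the interaction energy converges. -/
def IsTame (ρ : Plane → ℝ) : Prop :=
  Integrable ρ ∧ Integrable fun x => |ρ x| ^ (3 / 2 : ℝ)

theorem mul_mul_le_rpow {a b c : ℝ} (ha : 0 ≤ a) (hb : 0 ≤ b) (hc : 0 ≤ c) :
    a * b * c ≤ a ^ (3 / 2 : ℝ) * b ^ (3 / 2 : ℝ) + a ^ (3 / 2 : ℝ) * c ^ (3 / 2 : ℝ)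
      + b ^ (3 / 2 : ℝ) * c ^ (3 / 2 : ℝ) := by
  have key : ∀ {t : ℝ}, 0 ≤ t → t ^ (3 / 2 : ℝ) = √t ^ 3 := fun {t} ht => by
    rw [Real.sqrt_eq_rpow, ← Real.rpow_natCast, ← Real.rpow_mul ht]
    norm_num
  rw [key ha, key hb, key hc]
  have hu := Real.sqrt_nonneg a
  have hv := Real.sqrt_nonneg b
  have hw := Real.sqrt_nonneg c
  rw [← Real.sq_sqrt ha, ← Real.sq_sqrt hb, ← Real.sq_sqrt hc, Real.sqrt_sq hu, Real.sqrt_sq hv,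
    Real.sqrt_sq hw]
  generalize √a = u at *
  generalize √b = v at *
  generalize √c = w at *
  have h : ∀ x y z : ℝ, 0 ≤ x → 0 ≤ y → 0 ≤ z → x * y * z ≤ x ^ 3 + y ^ 3 + z ^ 3 := by
    intro x y z hx hy hz
    nlinarith [mul_nonneg (add_nonneg (add_nonneg hx hy) hz)
      (add_nonneg (add_nonneg (sq_nonneg (x - y)) (sq_nonneg (y - z))) (sq_nonneg (x - z))),
      mul_nonneg (mul_nonneg hx hy) hz]
  have := h (u * v) (u * w) (v * w) (by positivity) (by positivity) (by positivity)
  nlinarith [this]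

theorem IsTame.integrable_interaction {a b : Plane → ℝ} (ha : IsTame a) (hb : IsTame b) :
    Integrable fun p : Plane × Plane => a p.1 * b p.2 / ‖p.1 - p.2‖ := by
  have hk : Integrable fun z : Plane => nearKernel z ^ (3 / 2 : ℝ) :=
    integrable_nearKernel_rpow (by norm_num) (by norm_num)
  have h1 : Integrable fun p : Plane × Plane => |a p.1| * |b p.2| := ha.1.abs.mul_prod hb.1.abs
  have h2 : Integrable fun p : Plane × Plane =>
      |a p.1| ^ (3 / 2 : ℝ) * |b p.2| ^ (3 / 2 : ℝ) := ha.2.mul_prod hb.2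
  have h3 : Integrable fun p : Plane × Plane =>
      |b p.2| ^ (3 / 2 : ℝ) * nearKernel (p.1 - p.2) ^ (3 / 2 : ℝ) :=
    hb.2.convolution_integrand (ContinuousLinearMap.mul ℝ ℝ) hk
  have h4 : Integrable fun p : Plane × Plane =>
      |a p.1| ^ (3 / 2 : ℝ) * nearKernel (p.1 - p.2) ^ (3 / 2 : ℝ) := by
    have := (ha.2.convolution_integrand (ContinuousLinearMap.mul ℝ ℝ) hk).swap
    refine this.congr (Eventually.of_forall fun p => ?_)
    simp only [Function.comp_apply, Prod.fst_swap, Prod.snd_swap, ContinuousLinearMap.mul_apply']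
    rw [← nearKernel_neg, neg_sub]
  have hm : AEStronglyMeasurable (fun p : Plane × Plane => a p.1 * b p.2 / ‖p.1 - p.2‖)
      volume := by
    refine AEMeasurable.aestronglyMeasurable (AEMeasurable.div ?_ ?_)
    · exact (ha.1.1.comp_fst.mul hb.1.1.comp_snd).aemeasurable
    · exact (continuous_fst.sub continuous_snd).norm.aemeasurable
  refine (((h2.add h4).add h3).add h1).mono' hm (Eventually.of_forall fun p => ?_)
  have h5 := mul_mul_le_rpow (abs_nonneg (a p.1)) (abs_nonneg (b p.2))
    (nearKernel_nonneg (p.1 - p.2))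
  simp only [Pi.add_apply]
  rw [norm_div, norm_mul, norm_norm, Real.norm_eq_abs, Real.norm_eq_abs, div_eq_mul_one_div]
  calc |a p.1| * |b p.2| * (1 / ‖p.1 - p.2‖)
      ≤ |a p.1| * |b p.2| * (nearKernel (p.1 - p.2) + 1) := by
        gcongr
        exact one_div_norm_le _
    _ ≤ _ := by linarith

/-- The interaction energy `∬ a(x) b(y) / |x - y| dx dy` of two densities. -/
noncomputable def interaction (a b : Plane → ℝ) : ℝ :=
  ∫ p : Plane × Plane, a p.1 * b p.2 / ‖p.1 - p.2‖

theorem interaction_congr {a a' b b' : Plane → ℝ} (ha : a =ᵐ[volume] a') (hb : b =ᵐ[volume] b') :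
    interaction a b = interaction a' b' := by
  refine integral_congr_ae ?_
  have h1 : ∀ᵐ p : Plane × Plane, a p.1 = a' p.1 := Measure.quasiMeasurePreserving_fst.ae ha
  have h2 : ∀ᵐ p : Plane × Plane, b p.2 = b' p.2 := Measure.quasiMeasurePreserving_snd.ae hb
  filter_upwards [h1, h2] with p hp1 hp2
  rw [hp1, hp2]

theorem interaction_comm (a b : Plane → ℝ) : interaction a b = interaction b a := by
  rw [interaction, interaction, Measure.volume_eq_prod, ← integral_prod_swap]
  refine integral_congr_ae (Eventually.of_forall fun p => ?_)
  simp only [Prod.fst_swap, Prod.snd_swap]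
  rw [mul_comm, norm_sub_rev]

theorem interaction_eq_integral_mul_potential {a b : Plane → ℝ} (ha : IsTame a) (hb : IsTame b) :
    interaction a b = -∫ x, a x * potential b x := by
  rw [interaction, Measure.volume_eq_prod, integral_prod _ (ha.integrable_interaction hb),
    ← integral_neg]
  refine integral_congr_ae (Eventually.of_forall fun x => ?_)
  simp only [potential]
  rw [mul_neg, neg_neg, ← integral_const_mul]
  simp_rw [mul_div_assoc]

theorem potentialEnergy_eq {f : Plane × Plane → ℝ} (hf : IsTame (density f)) :
    potentialEnergy f = -(1 / 2) * interaction (density f) (density f) := by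
  rw [potentialEnergy, interaction_eq_integral_mul_potential hf hf]
  ring

theorem interaction_add_smul {a b : Plane → ℝ} (ha : IsTame a) (hb : IsTame b) (τ : ℝ) :
    interaction (fun x => a x + τ * b x) (fun x => a x + τ * b x)
      = interaction a a + 2 * τ * interaction b a + τ ^ 2 * interaction b b := by
  have e : ∀ p : Plane × Plane, (a p.1 + τ * b p.1) * (a p.2 + τ * b p.2) / ‖p.1 - p.2‖
      = a p.1 * a p.2 / ‖p.1 - p.2‖ + (τ * (a p.1 * b p.2 / ‖p.1 - p.2‖)
        + (τ * (b p.1 * a p.2 / ‖p.1 - p.2‖) + τ ^ 2 * (b p.1 * b p.2 / ‖p.1 - p.2‖))) :=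
    fun p => by ring
  have i1 := ha.integrable_interaction ha
  have i2 := (ha.integrable_interaction hb).const_mul τ
  have i3 := (hb.integrable_interaction ha).const_mul τ
  have i4 := (hb.integrable_interaction hb).const_mul (τ ^ 2)
  have h1 : interaction (fun x => a x + τ * b x) (fun x => a x + τ * b x)
      = interaction a a + (τ * interaction a b + (τ * interaction b a
        + τ ^ 2 * interaction b b)) := by
    simp only [interaction, e]
    have s1 := integral_add i3 i4
    have s2 := integral_add i2 (i3.add i4)
    have s3 := integral_add i1 (i2.add (i3.add i4))
    simp only [Pi.add_apply] at s1 s2 s3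
    rw [s3, s2, s1, integral_const_mul, integral_const_mul, integral_const_mul]
  rw [h1, interaction_comm a b]
  ring

end InteractionEnergy

section Density

/-- The velocity average estimate behind the `L^{3/2}` bound for the density: velocities up to
`|v|² ≤ r ^ (1 / 2)` are controlled by the square integral, larger ones by the kinetic energy. -/
theorem integral_rpow_le {g : Plane → ℝ} (hg : Integrable g) (hg2 : Integrable fun v => g v ^ 2)
    (hgv : Integrable fun v : Plane => ‖v‖ ^ 2 * |g v|) :
    |∫ v, g v| ^ (3 / 2 : ℝ)
      ≤ Real.pi * (∫ v, g v ^ 2) + 2 * ∫ v : Plane, ‖v‖ ^ 2 * |g v| := by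
  obtain ⟨r, hr⟩ : ∃ r, r = |∫ v, g v| := ⟨_, rfl⟩
  rw [← hr]
  have hA : 0 ≤ ∫ v, g v ^ 2 := integral_nonneg fun v => by positivity
  have hB : 0 ≤ ∫ v : Plane, ‖v‖ ^ 2 * |g v| := integral_nonneg fun v => by positivity
  have hπ := Real.pi_pos
  rcases (hr ▸ abs_nonneg _ : 0 ≤ r).eq_or_lt with h0 | h0
  · rw [← h0, Real.zero_rpow (by norm_num)]
    positivity
  obtain ⟨w, hw⟩ : ∃ w, w = √r := ⟨_, rfl⟩
  have hw0 : 0 < w := by rw [hw]; exact Real.sqrt_pos.2 h0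
  have hwr : w ^ 2 = r := by rw [hw, Real.sq_sqrt h0.le]
  -- `t` is such that the constant `t` on the ball `|v|² ≤ w` integrates to `r / 2`
  obtain ⟨t, ht⟩ : ∃ t, t = w / (2 * Real.pi) := ⟨_, rfl⟩
  have ht0 : 0 < t := by rw [ht]; positivity
  have hvol : (volume : Measure Plane).real (Metric.closedBall 0 √w) = Real.pi * w := by
    rw [Measure.real, EuclideanSpace.volume_closedBall_fin_two]
    simp only [ENNReal.toReal_mul, ENNReal.toReal_pow]
    rw [ENNReal.toReal_ofReal (Real.sqrt_nonneg _), Real.sq_sqrt hw0.le,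
      ENNReal.toReal_ofReal Real.pi_nonneg, mul_comm]
  have i1 : Integrable ((Metric.closedBall (0 : Plane) √w).indicator fun _ => t) := by
    rw [integrable_indicator_iff measurableSet_closedBall]
    exact integrableOn_const (measure_closedBall_lt_top.ne)
  have i2 := hg2.const_mul (1 / (4 * t))
  have i3 := hgv.const_mul (1 / w)
  have hpt : ∀ v, |g v| ≤ (Metric.closedBall (0 : Plane) √w).indicator (fun _ => t) v
      + (1 / (4 * t) * g v ^ 2 + 1 / w * (‖v‖ ^ 2 * |g v|)) := by
    intro v
    by_cases hv : v ∈ Metric.closedBall (0 : Plane) √w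
    · rw [indicator_of_mem hv]
      have h1 : |g v| ≤ t + 1 / (4 * t) * g v ^ 2 := by
        rw [← sq_abs (g v)]
        have : t + 1 / (4 * t) * |g v| ^ 2 - |g v| = (2 * t - |g v|) ^ 2 / (4 * t) := by
          field_simp; ring
        have h2 : 0 ≤ (2 * t - |g v|) ^ 2 / (4 * t) := by positivity
        linarith
      have h2 : 0 ≤ 1 / w * (‖v‖ ^ 2 * |g v|) := by positivity
      linarith
    · rw [indicator_of_notMem hv, zero_add]
      rw [mem_closedBall_zero_iff, not_le] at hv
      have h1 : w ≤ ‖v‖ ^ 2 := by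
        rw [← Real.sq_sqrt hw0.le]
        gcongr
      have h2 : |g v| ≤ 1 / w * (‖v‖ ^ 2 * |g v|) := by
        rw [← mul_assoc, one_div, inv_mul_eq_div]
        exact le_mul_of_one_le_left (abs_nonneg _) ((one_le_div hw0).2 h1)
      have h3 : 0 ≤ 1 / (4 * t) * g v ^ 2 := by positivity
      linarith
  have hint : r ≤ Real.pi * w * t + (1 / (4 * t) * (∫ v, g v ^ 2)
      + 1 / w * ∫ v : Plane, ‖v‖ ^ 2 * |g v|) := by
    calc r ≤ ∫ v, |g v| := by rw [hr]; exact abs_integral_le_integral_abs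
      _ ≤ ∫ v, ((Metric.closedBall (0 : Plane) √w).indicator (fun _ => t) v
            + (1 / (4 * t) * g v ^ 2 + 1 / w * (‖v‖ ^ 2 * |g v|))) :=
          integral_mono hg.abs (i1.add (i2.add i3)) hpt
      _ = _ := by
          have s1 := integral_add i1 (i2.add i3)
          have s2 := integral_add i2 i3
          simp only [Pi.add_apply] at s1 s2
          rw [s1, s2, integral_const_mul, integral_const_mul,
            integral_indicator measurableSet_closedBall, setIntegral_const, hvol, smul_eq_mul]
  have hrw : r ^ (3 / 2 : ℝ) = r * w := by
    rw [hw, Real.sqrt_eq_rpow, ← Real.rpow_one_add' h0.le (by norm_num)]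
    norm_num
  rw [hrw]
  rw [ht] at hint
  have e1 : Real.pi * w * (w / (2 * Real.pi)) = r / 2 := by
    rw [← hwr]; field_simp
  have e2 : 1 / (4 * (w / (2 * Real.pi))) = Real.pi / (2 * w) := by field_simp; norm_num
  rw [e1, e2] at hint
  have h2 := mul_le_mul_of_nonneg_right hint hw0.le
  have e3 : (r / 2 + (Real.pi / (2 * w) * (∫ v, g v ^ 2)
      + 1 / w * ∫ v : Plane, ‖v‖ ^ 2 * |g v|)) * w
      = r * w / 2 + (Real.pi * (∫ v, g v ^ 2) / 2 + ∫ v : Plane, ‖v‖ ^ 2 * |g v|) := by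
    field_simp
  rw [e3] at h2
  linarith

/-- The density of a square integrable function of finite kinetic energy is in `L¹ ∩ L^{3/2}`. -/
theorem isTame_density {f : Plane × Plane → ℝ} (hf : Integrable f)
    (hf2 : Integrable fun z => f z ^ 2)
    (hfv : Integrable fun z : Plane × Plane => ‖z.2‖ ^ 2 * f z) : IsTame (density f) := by
  have hρ : Integrable (density f) := Integrable.integral_prod_left hf
  have hfv' : Integrable fun z : Plane × Plane => ‖z.2‖ ^ 2 * |f z| := by
    refine hfv.abs.congr (Eventually.of_forall fun z => ?_)
    simp [abs_mul]
  refine ⟨hρ, ?_⟩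
  have i1 := (Integrable.integral_prod_left hf2).const_mul Real.pi
  have i2 := (Integrable.integral_prod_left hfv').const_mul 2
  refine (i1.add i2).mono' ?_ ?_
  · exact (hρ.1.aemeasurable.abs.pow_const _).aestronglyMeasurable
  · filter_upwards [hf.prod_right_ae, hf2.prod_right_ae, hfv'.prod_right_ae] with x h1 h2 h3
    rw [Real.norm_of_nonneg (by positivity)]
    exact integral_rpow_le h1 h2 h3

theorem CasimirAssumptions.exists_sq_le {Q : ℝ → ℝ} {μ₁ μ₂ μ₃ C₁ C₂ C₃ C₄ F₀ : ℝ}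
    (hQ : CasimirAssumptions Q μ₁ μ₂ μ₃ C₁ C₂ C₃ C₄ F₀) :
    ∃ D, 0 < D ∧ ∀ f, 0 ≤ f → f ^ 2 ≤ F₀ * f + D * Q f := by
  have hF := hQ.F₀_pos
  have hC := hQ.C₁_pos
  refine ⟨(C₁ * F₀ ^ (1 / μ₁ - 1))⁻¹, by positivity, fun f hf => ?_⟩
  have hQf := hQ.nonneg f hf
  have hD : 0 < C₁ * F₀ ^ (1 / μ₁ - 1) := by positivity
  rcases le_total f F₀ with h | h
  · have : 0 ≤ (C₁ * F₀ ^ (1 / μ₁ - 1))⁻¹ * Q f := by positivity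
    nlinarith
  · have hf0 : 0 < f := hF.trans_le h
    have h1 : f ^ 2 * (C₁ * F₀ ^ (1 / μ₁ - 1)) ≤ Q f := by
      refine le_trans ?_ (hQ.Q1 f h)
      have e : f ^ (1 + 1 / μ₁) = f ^ 2 * f ^ (1 / μ₁ - 1) := by
        rw [← Real.rpow_natCast, ← Real.rpow_add hf0]
        congr 1
        push_cast
        ring
      have hexp : 0 ≤ 1 / μ₁ - 1 := by
        rw [sub_nonneg, le_div_iff₀ hQ.μ₁_mem.1]
        linarith [hQ.μ₁_mem.2]
      have h2 : F₀ ^ (1 / μ₁ - 1) ≤ f ^ (1 / μ₁ - 1) := by gcongr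
      rw [e]
      calc f ^ 2 * (C₁ * F₀ ^ (1 / μ₁ - 1)) = C₁ * (f ^ 2 * F₀ ^ (1 / μ₁ - 1)) := by ring
        _ ≤ C₁ * (f ^ 2 * f ^ (1 / μ₁ - 1)) := by gcongr
    have h3 : f ^ 2 ≤ (C₁ * F₀ ^ (1 / μ₁ - 1))⁻¹ * Q f := by
      rw [le_inv_mul_iff₀ hD, mul_comm]
      exact h1
    have : 0 ≤ F₀ * f := by positivity
    linarith

theorem integrable_sq_of_mem_admissible {Q : ℝ → ℝ} {μ₁ μ₂ μ₃ C₁ C₂ C₃ C₄ F₀ M : ℝ}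
    (hQ : CasimirAssumptions Q μ₁ μ₂ μ₃ C₁ C₂ C₃ C₄ F₀) {f : Plane × Plane → ℝ}
    (hf : f ∈ admissible Q M) : Integrable fun z => f z ^ 2 := by
  obtain ⟨hfi, hf0, -, -, hfQ⟩ := hf
  obtain ⟨D, hD, h⟩ := hQ.exists_sq_le
  refine ((hfi.const_mul F₀).add (hfQ.const_mul D)).mono'
    (hfi.1.aemeasurable.pow_const 2).aestronglyMeasurable ?_
  filter_upwards [hf0] with z hz
  rw [Real.norm_of_nonneg (by positivity)]
  exact h _ hz

theorem isTame_density_of_mem_admissible {Q : ℝ → ℝ} {μ₁ μ₂ μ₃ C₁ C₂ C₃ C₄ F₀ M : ℝ}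
    (hQ : CasimirAssumptions Q μ₁ μ₂ μ₃ C₁ C₂ C₃ C₄ F₀) {f : Plane × Plane → ℝ}
    (hf : f ∈ admissible Q M) : IsTame (density f) :=
  isTame_density hf.1 (integrable_sq_of_mem_admissible hQ hf) hf.2.2.2.1

end Density

/-! ### Rotations -/

section Rotation

theorem exists_linearIsometryEquiv_of_mem_specialOrthogonalGroup {A : Matrix (Fin 2) (Fin 2) ℝ}
    (hA : A ∈ Matrix.specialOrthogonalGroup (Fin 2) ℝ) :
    ∃ L : Plane ≃ₗᵢ[ℝ] Plane, ∀ x, L x = Matrix.toEuclideanLin A x := by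
  have h1 : star A * A = 1 := (Matrix.mem_specialOrthogonalGroup_iff.1 hA).1.1
  have h00 := congr_fun (congr_fun h1 0) 0
  have h01 := congr_fun (congr_fun h1 0) 1
  have h11 := congr_fun (congr_fun h1 1) 1
  simp [Matrix.mul_apply, Fin.sum_univ_two, Matrix.star_apply] at h00 h01 h11
  have hnorm : ∀ x : Plane, ‖Matrix.toEuclideanLin A x‖ = ‖x‖ := by
    intro x
    rw [← sq_eq_sq₀ (norm_nonneg _) (norm_nonneg _), EuclideanSpace.norm_sq_eq,
      EuclideanSpace.norm_sq_eq, Fin.sum_univ_two, Fin.sum_univ_two]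
    simp only [Matrix.toLpLin_apply, Matrix.mulVec, dotProduct, Fin.sum_univ_two,
      Real.norm_eq_abs, sq_abs]
    linear_combination x 0 ^ 2 * h00 + 2 * x 0 * x 1 * h01 + x 1 ^ 2 * h11
  exact ⟨LinearIsometry.toLinearIsometryEquiv ⟨Matrix.toEuclideanLin A, hnorm⟩ rfl, fun x => rfl⟩

variable (L : Plane ≃ₗᵢ[ℝ] Plane)

theorem density_comp_ae {f : Plane × Plane → ℝ}
    (hf : ∀ᵐ z : Plane × Plane, f (L z.1, L z.2) = f z) :
    ∀ᵐ x, density f (L x) = density f x := by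
  filter_upwards [Measure.ae_ae_of_ae_prod hf] with x hx
  have h1 := L.measurePreserving.integral_comp L.toMeasurableEquiv.measurableEmbedding
    (fun v => f (L x, v))
  rw [density, ← h1]
  exact integral_congr_ae hx

theorem potential_comp {ρ : Plane → ℝ} (hρ : ∀ᵐ x, ρ (L x) = ρ x) (x : Plane) :
    potential ρ (L x) = potential ρ x := by
  have h1 := L.measurePreserving.integral_comp L.toMeasurableEquiv.measurableEmbedding
    (fun y => ρ y / ‖L x - y‖)
  rw [potential, potential, ← h1]
  congr 1
  refine integral_congr_ae ?_
  filter_upwards [hρ] with y hy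
  rw [hy, ← map_sub, L.norm_map]

end Rotation

/-! ### Variation of the energy-Casimir functional -/

section Variation

variable {Q : ℝ → ℝ} {μ₁ μ₂ μ₃ C₁ C₂ C₃ C₄ F₀ M : ℝ}

/-- The second order expansion of the energy-Casimir functional, up to the Casimir part. -/
theorem energyCasimir_add_smul (hQ : CasimirAssumptions Q μ₁ μ₂ μ₃ C₁ C₂ C₃ C₄ F₀)
    {f h : Plane × Plane → ℝ} (hf : f ∈ admissible Q M) (hh : Integrable h)
    (hh2 : Integrable fun z => h z ^ 2) (hhv : Integrable fun z : Plane × Plane => ‖z.2‖ ^ 2 * h z)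
    (hhU : Integrable fun z : Plane × Plane => h z * potential (density f) z.1) {τ : ℝ}
    (hg : (fun z => f z + τ * h z) ∈ admissible Q M) :
    energyCasimir Q (fun z => f z + τ * h z) = energyCasimir Q f
      + (∫ z, (Q (f z + τ * h z) - Q (f z)
        + τ * (h z * (‖z.2‖ ^ 2 / 2 + potential (density f) z.1))))
      - τ ^ 2 / 2 * interaction (density h) (density h) := by
  have tf := isTame_density_of_mem_admissible hQ hf
  have tg := isTame_density_of_mem_admissible hQ hg
  have th := isTame_density hh hh2 hhv
  have hρ : density (fun z => f z + τ * h z) =ᵐ[volume] fun x => density f x + τ * density h x := by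
    filter_upwards [hf.1.prod_right_ae, hh.prod_right_ae] with x h1 h2
    rw [density, integral_add h1 (h2.const_mul τ), integral_const_mul]
    rfl
  have hpot : potentialEnergy (fun z => f z + τ * h z) = potentialEnergy f
      + τ * (∫ z : Plane × Plane, h z * potential (density f) z.1)
      - τ ^ 2 / 2 * interaction (density h) (density h) := by
    rw [potentialEnergy_eq tg, potentialEnergy_eq tf, interaction_congr hρ hρ,
      interaction_add_smul tf th, interaction_eq_integral_mul_potential th tf]
    have : ∫ z : Plane × Plane, h z * potential (density f) z.1
        = ∫ x, density h x * potential (density f) x := by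
      rw [Measure.volume_eq_prod, integral_prod _ hhU]
      simp_rw [integral_mul_const]
      rfl
    rw [this]
    ring
  have hkin : kineticEnergy (fun z => f z + τ * h z) = kineticEnergy f
      + τ * (∫ z : Plane × Plane, ‖z.2‖ ^ 2 * h z) / 2 := by
    simp only [kineticEnergy]
    have : ∀ z : Plane × Plane, ‖z.2‖ ^ 2 * (f z + τ * h z)
        = ‖z.2‖ ^ 2 * f z + τ * (‖z.2‖ ^ 2 * h z) := fun z => by ring
    simp_rw [this]
    rw [integral_add hf.2.2.2.1 (hhv.const_mul τ), integral_const_mul]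
    ring
  have hi1 : Integrable fun z => Q (f z + τ * h z) - Q (f z) := hg.2.2.2.2.sub hf.2.2.2.2
  have hi2 : Integrable fun z : Plane × Plane => τ / 2 * (‖z.2‖ ^ 2 * h z) := hhv.const_mul _
  have hi3 : Integrable fun z : Plane × Plane => τ * (h z * potential (density f) z.1) :=
    hhU.const_mul _
  have hsum : (∫ z, (Q (f z + τ * h z) - Q (f z)
        + τ * (h z * (‖z.2‖ ^ 2 / 2 + potential (density f) z.1))))
      = casimir Q (fun z => f z + τ * h z) - casimir Q f
        + τ * (∫ z : Plane × Plane, ‖z.2‖ ^ 2 * h z) / 2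
        + τ * ∫ z : Plane × Plane, h z * potential (density f) z.1 := by
    have e : ∀ z : Plane × Plane, Q (f z + τ * h z) - Q (f z)
        + τ * (h z * (‖z.2‖ ^ 2 / 2 + potential (density f) z.1))
        = Q (f z + τ * h z) - Q (f z)
          + (τ / 2 * (‖z.2‖ ^ 2 * h z) + τ * (h z * potential (density f) z.1)) := fun z => by
      ring
    simp_rw [e]
    have s1 := integral_add hi2 hi3
    have s2 := integral_add hi1 (hi2.add hi3)
    have s3 := integral_sub hg.2.2.2.2 hf.2.2.2.2
    simp only [Pi.add_apply] at s1 s2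
    rw [s2, s1, s3, integral_const_mul, integral_const_mul]
    simp only [casimir]
    ring
  rw [hsum]
  simp only [energyCasimir]
  rw [hpot, hkin]
  ring

theorem CasimirAssumptions.le_of_add (hQ : CasimirAssumptions Q μ₁ μ₂ μ₃ C₁ C₂ C₃ C₄ F₀)
    {f s ε : ℝ} (hf : 0 ≤ f) (hs : 0 < s)
    (hε : ∀ c, f < c → c < f + s → dQ Q c ≤ dQ Q f + ε) :
    Q (f + s) - Q f ≤ s * (dQ Q f + ε) := by
  obtain ⟨c, hc, h⟩ := hQ.exists_sub_eq hf (by linarith : f < f + s)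
  rw [h, add_sub_cancel_left, mul_comm]
  exact mul_le_mul_of_nonneg_left (hε c hc.1 hc.2) hs.le

theorem CasimirAssumptions.le_of_sub (hQ : CasimirAssumptions Q μ₁ μ₂ μ₃ C₁ C₂ C₃ C₄ F₀)
    {f s ε : ℝ} (hf : s ≤ f) (hs : 0 < s)
    (hε : ∀ c, f - s < c → c < f → dQ Q f - ε ≤ dQ Q c) :
    Q (f - s) - Q f ≤ -(s * (dQ Q f - ε)) := by
  obtain ⟨c, hc, h⟩ := hQ.exists_sub_eq (by linarith : 0 ≤ f - s) (by linarith : f - s < f)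
  have h1 := mul_le_mul_of_nonneg_left (hε c hc.1 hc.2) hs.le
  rw [sub_sub_cancel] at h
  linarith

theorem CasimirAssumptions.measurable_comp (hQ : CasimirAssumptions Q μ₁ μ₂ μ₃ C₁ C₂ C₃ C₄ F₀)
    {X : Type*} [MeasurableSpace X] {f : X → ℝ} (hf : Measurable f) (hf0 : ∀ z, 0 ≤ f z) :
    Measurable fun z => Q (f z) := by
  have h1 : Continuous fun t : ℝ => Q (max 0 t) :=
    hQ.contDiffOn.continuousOn.comp_continuous (by fun_prop) fun t => le_max_left 0 t
  have e : (fun z => Q (f z)) = (fun t : ℝ => Q (max 0 t)) ∘ f := by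
    funext z
    simp [max_eq_right (hf0 z)]
  rw [e]
  exact h1.measurable.comp hf

theorem CasimirAssumptions.measurable_dQ_comp
    (hQ : CasimirAssumptions Q μ₁ μ₂ μ₃ C₁ C₂ C₃ C₄ F₀)
    {X : Type*} [MeasurableSpace X] {f : X → ℝ} (hf : Measurable f) (hf0 : ∀ z, 0 ≤ f z) :
    Measurable fun z => dQ Q (f z) := by
  have e : (fun z => dQ Q (f z)) = dQExt Q ∘ f := by
    funext z
    simp [dQExt, hf0 z]
  rw [e]
  exact hQ.strictMono_dQExt.monotone.measurable.comp hf

/-- The Lagrangian density `Q'(f) + |v|² / 2 + U_f` whose constancy on the support of a minimizer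
is the Euler-Lagrange equation. -/
noncomputable def lagrangian (Q : ℝ → ℝ) (f : Plane × Plane → ℝ) (z : Plane × Plane) : ℝ :=
  dQ Q (f z) + ‖z.2‖ ^ 2 / 2 + potential (density f) z.1

end Variation

/-! ### The Euler-Lagrange equation -/

section EulerLagrange

variable {Q : ℝ → ℝ} {μ₁ μ₂ μ₃ C₁ C₂ C₃ C₄ F₀ M : ℝ}

theorem measurable_potential {f : Plane × Plane → ℝ} (hf : Measurable f) :
    Measurable (potential (density f)) := by
  have h1 : StronglyMeasurable (density f) :=
    hf.stronglyMeasurable.integral_prod_right' (ν := volume)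
  have h2 : Measurable fun p : Plane × Plane => density f p.2 / ‖p.1 - p.2‖ :=
    (h1.measurable.comp measurable_snd).div (measurable_fst.sub measurable_snd).norm
  exact (h2.stronglyMeasurable.integral_prod_right' (ν := volume)).measurable.neg

theorem measurable_lagrangian (hQ : CasimirAssumptions Q μ₁ μ₂ μ₃ C₁ C₂ C₃ C₄ F₀)
    {f : Plane × Plane → ℝ} (hf : Measurable f) (hf0 : ∀ z, 0 ≤ f z) :
    Measurable (lagrangian Q f) :=
  ((hQ.measurable_dQ_comp hf hf0).add ((measurable_snd.norm.pow_const 2).div_const 2)).add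
    ((measurable_potential hf).comp measurable_fst)

/-- The region of phase space where `f`, the positions, the velocities and the potential are
bounded by `n`. -/
def boundedRegion (f : Plane × Plane → ℝ) (n : ℝ) : Set (Plane × Plane) :=
  {z | f z < n ∧ ‖z.1‖ < n ∧ ‖z.2‖ < n ∧ |potential (density f) z.1| < n}

theorem measurableSet_boundedRegion {f : Plane × Plane → ℝ} (hf : Measurable f) (n : ℝ) :
    MeasurableSet (boundedRegion f n) := by
  have h1 : MeasurableSet {z : Plane × Plane | |potential (density f) z.1| < n} :=
    measurableSet_lt ((measurable_potential hf).comp measurable_fst).norm measurable_const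
  exact (measurableSet_lt hf measurable_const).inter
    ((measurableSet_lt measurable_fst.norm measurable_const).inter
    ((measurableSet_lt measurable_snd.norm measurable_const).inter h1))

theorem volume_boundedRegion_lt_top (f : Plane × Plane → ℝ) (n : ℝ) :
    volume (boundedRegion f n) < ⊤ := by
  have h : boundedRegion f n ⊆ Metric.ball 0 n ×ˢ Metric.ball 0 n := fun z hz =>
    ⟨mem_ball_zero_iff.2 hz.2.1, mem_ball_zero_iff.2 hz.2.2.1⟩
  refine (measure_mono h).trans_lt ?_
  rw [Measure.volume_eq_prod, Measure.prod_prod]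
  exact ENNReal.mul_lt_top measure_ball_lt_top measure_ball_lt_top

/-- A minimizer does not admit a gain from moving mass out of a set `B` where the Lagrangian
density exceeds `b` into a set `A` where it is less than `a < b`. -/
theorem false_of_exchange (hQ : CasimirAssumptions Q μ₁ μ₂ μ₃ C₁ C₂ C₃ C₄ F₀)
    {f : Plane × Plane → ℝ} (hf : f ∈ admissibleSymm Q M) (hfm : Measurable f)
    (hf0 : ∀ z, 0 ≤ f z) (hmin : IsMinOn (energyCasimir Q) (admissibleSymm Q M) f)
    {a b n δ₀ : ℝ} (hab : a < b) (hδ₀ : 0 < δ₀) {A B : Set (Plane × Plane)}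
    (hA : MeasurableSet A) (hB : MeasurableSet B)
    (hAn : A ⊆ boundedRegion f n) (hBn : B ⊆ boundedRegion f n)
    (hAa : ∀ z ∈ A, lagrangian Q f z < a) (hBb : ∀ z ∈ B, b < lagrangian Q f z)
    (hBδ : ∀ z ∈ B, δ₀ < f z) (hA0 : volume A ≠ 0) (hB0 : volume B ≠ 0)
    (hsymm : ∀ R ∈ Matrix.specialOrthogonalGroup (Fin 2) ℝ, ∀ᵐ z : Plane × Plane,
      ((Matrix.toEuclideanLin R z.1, Matrix.toEuclideanLin R z.2) ∈ A ↔ z ∈ A) ∧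
      ((Matrix.toEuclideanLin R z.1, Matrix.toEuclideanLin R z.2) ∈ B ↔ z ∈ B)) : False := by
  have hAfin : volume A ≠ ⊤ := ((measure_mono hAn).trans_lt (volume_boundedRegion_lt_top f n)).ne
  have hBfin : volume B ≠ ⊤ := ((measure_mono hBn).trans_lt (volume_boundedRegion_lt_top f n)).ne
  have hn : 0 ≤ n := by
    obtain ⟨z, hz⟩ := nonempty_of_measure_ne_zero hA0
    exact (hf0 z).trans (hAn hz).1.le
  obtain ⟨α, hα⟩ : ∃ α, α = volume.real A := ⟨_, rfl⟩
  obtain ⟨β, hβ⟩ : ∃ β, β = volume.real B := ⟨_, rfl⟩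
  have hα0 : 0 < α := by rw [hα]; exact ENNReal.toReal_pos hA0 hAfin
  have hβ0 : 0 < β := by rw [hβ]; exact ENNReal.toReal_pos hB0 hBfin
  have hdisj : ∀ z ∈ A, z ∉ B := fun z hzA hzB => by linarith [hAa z hzA, hBb z hzB]
  obtain ⟨hA', hhA'⟩ : ∃ k : Plane × Plane → ℝ, k = A.indicator fun _ => α⁻¹ := ⟨_, rfl⟩
  obtain ⟨hB', hhB'⟩ : ∃ k : Plane × Plane → ℝ, k = B.indicator fun _ => β⁻¹ := ⟨_, rfl⟩
  obtain ⟨h, hh⟩ : ∃ h : Plane × Plane → ℝ, h = fun z => hA' z - hB' z := ⟨_, rfl⟩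
  have iA : Integrable hA' := by
    rw [hhA', integrable_indicator_iff hA]; exact integrableOn_const hAfin
  have iB : Integrable hB' := by
    rw [hhB', integrable_indicator_iff hB]; exact integrableOn_const hBfin
  have intA : ∫ z, hA' z = 1 := by
    rw [hhA', integral_indicator hA, setIntegral_const, ← hα, smul_eq_mul,
      mul_inv_cancel₀ hα0.ne']
  have intB : ∫ z, hB' z = 1 := by
    rw [hhB', integral_indicator hB, setIntegral_const, ← hβ, smul_eq_mul,
      mul_inv_cancel₀ hβ0.ne']
  have hhm : Measurable h := by
    rw [hh, hhA', hhB']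
    exact (measurable_const.indicator hA).sub (measurable_const.indicator hB)
  have hvA : ∀ z ∈ A, h z = α⁻¹ := fun z hz => by
    simp [hh, hhA', hhB', hz, hdisj z hz]
  have hvB : ∀ z ∈ B, h z = -β⁻¹ := fun z hz => by
    have : z ∉ A := fun hzA => hdisj z hzA hz
    simp [hh, hhA', hhB', hz, this]
  have hv0 : ∀ z, z ∉ A → z ∉ B → h z = 0 := fun z hzA hzB => by
    simp [hh, hhA', hhB', hzA, hzB]
  have hABm : MeasurableSet (A ∪ B) := hA.union hB
  have hABfin : volume (A ∪ B) ≠ ⊤ := (measure_union_lt_top hAfin.lt_top hBfin.lt_top).ne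
  -- measurable functions that are bounded on `A ∪ B` and vanish outside are integrable
  have hint : ∀ (k : Plane × Plane → ℝ) (K : ℝ), Measurable k → (∀ z ∈ A ∪ B, |k z| ≤ K) →
      (∀ z, z ∉ A → z ∉ B → k z = 0) → Integrable k := by
    intro k K hk hK hk0
    have i1 : Integrable ((A ∪ B).indicator fun _ => K) := by
      rw [integrable_indicator_iff hABm]; exact integrableOn_const hABfin
    refine i1.mono' hk.aestronglyMeasurable (Eventually.of_forall fun z => ?_)
    by_cases hz : z ∈ A ∪ B
    · rw [indicator_of_mem hz]; exact hK z hz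
    · rw [indicator_of_notMem hz, hk0 z (fun h' => hz (Or.inl h')) fun h' => hz (Or.inr h'),
        norm_zero]
  have hreg : ∀ z ∈ A ∪ B, z ∈ boundedRegion f n := fun z hz => hz.elim (hAn ·) (hBn ·)
  have hhb : ∀ z, |h z| ≤ α⁻¹ + β⁻¹ := by
    have h1 : 0 < α⁻¹ := inv_pos.2 hα0
    have h2 : 0 < β⁻¹ := inv_pos.2 hβ0
    intro z
    by_cases hzA : z ∈ A
    · rw [hvA z hzA, abs_of_pos h1]; linarith
    by_cases hzB : z ∈ B
    · rw [hvB z hzB, abs_neg, abs_of_pos h2]; linarith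
    · rw [hv0 z hzA hzB, abs_zero]; linarith
  have hK0 : 0 ≤ α⁻¹ + β⁻¹ := by positivity
  have ih : Integrable h := by rw [hh]; exact iA.sub iB
  have ih2 : Integrable fun z => h z ^ 2 := by
    refine hint _ ((α⁻¹ + β⁻¹) ^ 2) (hhm.pow_const 2) (fun z _ => ?_) fun z hzA hzB => ?_
    · rw [abs_pow]
      gcongr
      exact hhb z
    · rw [hv0 z hzA hzB]; norm_num
  have ihv : Integrable fun z : Plane × Plane => ‖z.2‖ ^ 2 * h z := by
    refine hint _ (n ^ 2 * (α⁻¹ + β⁻¹)) ((measurable_snd.norm.pow_const 2).mul hhm)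
      (fun z hz => ?_) fun z hzA hzB => ?_
    · rw [abs_mul, abs_of_nonneg (by positivity)]
      have := (hreg z hz).2.2.1
      gcongr
      exact hhb z
    · rw [hv0 z hzA hzB, mul_zero]
  have ihU : Integrable fun z : Plane × Plane => h z * potential (density f) z.1 := by
    refine hint _ ((α⁻¹ + β⁻¹) * n) (hhm.mul ((measurable_potential hfm).comp measurable_fst))
      (fun z hz => ?_) fun z hzA hzB => ?_
    · rw [abs_mul]
      have := (hreg z hz).2.2.2
      gcongr
      exact hhb z
    · rw [hv0 z hzA hzB, zero_mul]
  obtain ⟨ε, hε⟩ : ∃ ε, ε = (b - a) / 4 := ⟨_, rfl⟩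
  have hε0 : 0 < ε := by rw [hε]; linarith
  -- the modulus of continuity of `Q'` on the relevant range of values
  obtain ⟨δ, hδ, huc⟩ : ∃ δ > 0, ∀ x ∈ Icc 0 (n + 1), ∀ y ∈ Icc 0 (n + 1), dist x y < δ →
      dist (dQ Q x) (dQ Q y) < ε := by
    have := isCompact_Icc.uniformContinuousOn_of_continuous
      (hQ.continuousOn_dQ.mono fun x (hx : x ∈ Icc 0 (n + 1)) => hx.1)
    obtain ⟨δ, hδ, h'⟩ := Metric.uniformContinuousOn_iff.1 this ε hε0
    exact ⟨δ, hδ, h'⟩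
  obtain ⟨W, hW⟩ : ∃ W, W = interaction (density h) (density h) := ⟨_, rfl⟩
  -- the mass `τ` to be moved: small enough that the competitor stays nonnegative and `Q'` varies by
  -- at most `ε`, and that the quadratic term `τ² W / 2` is dominated by the gain `τ (b - a) / 2`
  obtain ⟨m, hm⟩ : ∃ m, m = min (min δ₀ δ) 1 := ⟨_, rfl⟩
  have hm0 : 0 < m := by rw [hm]; exact lt_min (lt_min hδ₀ hδ) one_pos
  obtain ⟨τ, hτ⟩ : ∃ τ, τ = min (min (m * α) (m * β)) ((b - a) / 2 / (|W| + 1)) := ⟨_, rfl⟩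
  have hba : 0 < b - a := by linarith
  have hτ0 : 0 < τ := by rw [hτ]; positivity
  have hτα : τ * α⁻¹ ≤ m := by
    rw [← div_eq_mul_inv, div_le_iff₀ hα0, hτ]
    exact (min_le_left _ _).trans (min_le_left _ _)
  have hτβ : τ * β⁻¹ ≤ m := by
    rw [← div_eq_mul_inv, div_le_iff₀ hβ0, hτ]
    exact (min_le_left _ _).trans (min_le_right _ _)
  have hτW : τ * |W| < b - a := by
    have h1 : τ * (|W| + 1) ≤ (b - a) / 2 := by
      rw [← le_div_iff₀ (by positivity), hτ]
      exact min_le_right _ _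
    have h2 : 0 ≤ |W| := abs_nonneg W
    linarith
  have hm1 : m ≤ δ₀ := by rw [hm]; exact (min_le_left _ _).trans (min_le_left _ _)
  have hm2 : m ≤ δ := by rw [hm]; exact (min_le_left _ _).trans (min_le_right _ _)
  have hm3 : m ≤ 1 := by rw [hm]; exact min_le_right _ _
  have hsα : 0 < τ * α⁻¹ := by positivity
  have hsβ : 0 < τ * β⁻¹ := by positivity
  have hg0 : ∀ z, 0 ≤ f z + τ * h z := by
    intro z
    by_cases hzA : z ∈ A
    · rw [hvA z hzA]; linarith [hf0 z]
    by_cases hzB : z ∈ B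
    · rw [hvB z hzB]; linarith [hBδ z hzB]
    · rw [hv0 z hzA hzB]; linarith [hf0 z]
  have hgm : Measurable fun z => f z + τ * h z := hfm.add (hhm.const_mul τ)
  have hgle : ∀ z ∈ A ∪ B, f z + τ * h z ≤ n + 1 := by
    intro z hz
    have h1 := (hreg z hz).1
    rcases hz with hzA | hzB
    · rw [hvA z hzA]; linarith
    · rw [hvB z hzB]; linarith
  obtain ⟨K, hK⟩ := (isCompact_Icc (a := (0 : ℝ)) (b := n + 1)).exists_bound_of_continuousOn
    (hQ.contDiffOn.continuousOn.mono fun x hx => hx.1)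
  have iQ : Integrable fun z => Q (f z + τ * h z) - Q (f z) := by
    refine hint _ (K + K) ((hQ.measurable_comp hgm hg0).sub (hQ.measurable_comp hfm hf0))
      (fun z hz => ?_) fun z hzA hzB => ?_
    · refine (abs_sub _ _).trans (add_le_add (hK _ ⟨hg0 z, hgle z hz⟩) (hK _ ⟨hf0 z, ?_⟩))
      linarith [(hreg z hz).1]
    · rw [hv0 z hzA hzB, mul_zero, add_zero, sub_self]
  have hgadm : (fun z => f z + τ * h z) ∈ admissibleSymm Q M := by
    refine ⟨⟨hf.1.1.add (ih.const_mul τ), Eventually.of_forall hg0, ?_, ?_, ?_⟩, fun R hR => ?_⟩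
    · rw [integral_add hf.1.1 (ih.const_mul τ), integral_const_mul, hf.1.2.2.1, hh,
        integral_sub iA iB, intA, intB, sub_self, mul_zero, add_zero]
    · refine (hf.1.2.2.2.1.add (ihv.const_mul τ)).congr (Eventually.of_forall fun z => ?_)
      simp only [Pi.add_apply]
      ring
    · refine (hf.1.2.2.2.2.add iQ).congr (Eventually.of_forall fun z => ?_)
      simp only [Pi.add_apply]
      ring
    · filter_upwards [hf.2 R hR, hsymm R hR] with z h1 h2
      rw [h1]
      congr 2
      by_cases hzA : z ∈ A
      · rw [hvA z hzA, hvA _ (h2.1.2 hzA)]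
      by_cases hzB : z ∈ B
      · rw [hvB z hzB, hvB _ (h2.2.2 hzB)]
      · rw [hv0 z hzA hzB, hv0 _ (fun h' => hzA (h2.1.1 h')) fun h' => hzB (h2.2.1 h')]
  have hD := energyCasimir_add_smul hQ hf.1 ih ih2 ihv ihU hgadm.1
  have hDle : energyCasimir Q f ≤ energyCasimir Q fun z => f z + τ * h z := hmin hgadm
  have hpt : ∀ z, Q (f z + τ * h z) - Q (f z)
      + τ * (h z * (‖z.2‖ ^ 2 / 2 + potential (density f) z.1))
      ≤ τ * ((a + ε) * hA' z - (b - ε) * hB' z) := by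
    intro z
    by_cases hzA : z ∈ A
    · have hreg' := hAn hzA
      have h1 : Q (f z + τ * α⁻¹) - Q (f z) ≤ τ * α⁻¹ * (dQ Q (f z) + ε) := by
        refine hQ.le_of_add (hf0 z) hsα fun c hc1 hc2 => ?_
        have := huc c ⟨(hf0 z).trans hc1.le, by linarith [hreg'.1]⟩ (f z)
          ⟨hf0 z, by linarith [hreg'.1]⟩ (by rw [Real.dist_eq, abs_lt]; constructor <;> linarith)
        rw [Real.dist_eq, abs_lt] at this
        linarith
      have h2 : τ * α⁻¹ * lagrangian Q f z ≤ τ * α⁻¹ * a :=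
        mul_le_mul_of_nonneg_left (hAa z hzA).le hsα.le
      have h3 : hA' z = α⁻¹ := by simp [hhA', hzA]
      have h4 : hB' z = 0 := by simp [hhB', hdisj z hzA]
      rw [lagrangian] at h2
      rw [hvA z hzA, h3, h4]
      linarith
    by_cases hzB : z ∈ B
    · have hreg' := hBn hzB
      have hfz := hBδ z hzB
      have h1 : Q (f z - τ * β⁻¹) - Q (f z) ≤ -(τ * β⁻¹ * (dQ Q (f z) - ε)) := by
        refine hQ.le_of_sub (by linarith) hsβ fun c hc1 hc2 => ?_
        have := huc c ⟨by linarith, by linarith [hreg'.1]⟩ (f z)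
          ⟨hf0 z, by linarith [hreg'.1]⟩ (by rw [Real.dist_eq, abs_lt]; constructor <;> linarith)
        rw [Real.dist_eq, abs_lt] at this
        linarith
      have h2 : τ * β⁻¹ * b ≤ τ * β⁻¹ * lagrangian Q f z :=
        mul_le_mul_of_nonneg_left (hBb z hzB).le hsβ.le
      have h3 : hA' z = 0 := by simp [hhA', hzA]
      have h4 : hB' z = β⁻¹ := by simp [hhB', hzB]
      rw [lagrangian] at h2
      rw [hvB z hzB, h3, h4, mul_neg, ← sub_eq_add_neg]
      linarith
    · have h3 : hA' z = 0 := by simp [hhA', hzA]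
      have h4 : hB' z = 0 := by simp [hhB', hzB]
      rw [hv0 z hzA hzB, h3, h4]
      simp
  have hi1 : Integrable fun z : Plane × Plane => Q (f z + τ * h z) - Q (f z)
      + τ * (h z * (‖z.2‖ ^ 2 / 2 + potential (density f) z.1)) := by
    refine (iQ.add (((ihv.const_mul (1 / 2)).add ihU).const_mul τ)).congr
      (Eventually.of_forall fun z => ?_)
    simp only [Pi.add_apply]
    ring
  have hle := integral_mono hi1 (((iA.const_mul (a + ε)).sub (iB.const_mul (b - ε))).const_mul τ)
    hpt
  have s1 : ∫ z, τ * ((a + ε) * hA' z - (b - ε) * hB' z) = -(τ * ((b - a) / 2)) := by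
    rw [integral_const_mul, integral_sub (iA.const_mul _) (iB.const_mul _), integral_const_mul,
      integral_const_mul, intA, intB, hε]
    ring
  simp only [Pi.sub_apply] at hle
  rw [s1] at hle
  rw [← hW] at hD
  have h5 : τ * ((b - a) / 2) ≤ -(τ ^ 2 / 2 * W) := by linarith
  have h6 : -W ≤ |W| := neg_le_abs W
  nlinarith [mul_lt_mul_of_pos_left hτW hτ0, mul_le_mul_of_nonneg_left h6 (sq_nonneg τ)]

theorem boundedRegion_mono (f : Plane × Plane → ℝ) {m n : ℝ} (h : m ≤ n) :
    boundedRegion f m ⊆ boundedRegion f n := fun _ hz =>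
  ⟨hz.1.trans_le h, hz.2.1.trans_le h, hz.2.2.1.trans_le h, hz.2.2.2.trans_le h⟩

theorem exists_mem_boundedRegion (f : Plane × Plane → ℝ) (z : Plane × Plane) :
    ∃ n : ℕ, z ∈ boundedRegion f n := by
  obtain ⟨n, hn⟩ := exists_nat_gt (max (max (f z) ‖z.1‖) (max ‖z.2‖ |potential (density f) z.1|))
  simp only [max_lt_iff] at hn
  exact ⟨n, hn.1.1, hn.1.2, hn.2.1, hn.2.2⟩

/-- The Lagrangian density and the bounded regions inherit the axial symmetry. -/
theorem symmetric_lagrangian {f : Plane × Plane → ℝ} (hf : IsAxiallySymmetric f)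
    {R : Matrix (Fin 2) (Fin 2) ℝ} (hR : R ∈ Matrix.specialOrthogonalGroup (Fin 2) ℝ) :
    ∀ᵐ z : Plane × Plane,
      f (Matrix.toEuclideanLin R z.1, Matrix.toEuclideanLin R z.2) = f z ∧
      lagrangian Q f (Matrix.toEuclideanLin R z.1, Matrix.toEuclideanLin R z.2)
        = lagrangian Q f z ∧
      ∀ n, ((Matrix.toEuclideanLin R z.1, Matrix.toEuclideanLin R z.2) ∈ boundedRegion f n ↔
        z ∈ boundedRegion f n) := by
  obtain ⟨L, hL⟩ := exists_linearIsometryEquiv_of_mem_specialOrthogonalGroup hR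
  have h1 : ∀ᵐ z : Plane × Plane, f (L z.1, L z.2) = f z := by
    filter_upwards [hf R hR] with z hz
    rwa [hL, hL]
  have h2 := potential_comp L (density_comp_ae L h1)
  filter_upwards [h1] with z hz
  rw [← hL, ← hL]
  refine ⟨hz, ?_, fun n => ?_⟩
  · simp only [lagrangian, hz, h2, L.norm_map]
  · simp only [boundedRegion, mem_ofPred_eq, hz, h2, L.norm_map]

theorem measure_lagrangian_lt_eq_zero_or (hQ : CasimirAssumptions Q μ₁ μ₂ μ₃ C₁ C₂ C₃ C₄ F₀)
    {f : Plane × Plane → ℝ} (hf : f ∈ admissibleSymm Q M) (hfm : Measurable f)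
    (hf0 : ∀ z, 0 ≤ f z) (hmin : IsMinOn (energyCasimir Q) (admissibleSymm Q M) f)
    {a b : ℝ} (hab : a < b) :
    volume {z | lagrangian Q f z < a} = 0 ∨ volume {z | b < lagrangian Q f z ∧ 0 < f z} = 0 := by
  by_contra! hcon
  obtain ⟨hA, hB⟩ := hcon
  have hGm := measurable_lagrangian hQ hfm hf0
  have hA' : {z | lagrangian Q f z < a}
      ⊆ ⋃ n : ℕ, {z | lagrangian Q f z < a} ∩ boundedRegion f n := fun z hz => by
    obtain ⟨n, hn⟩ := exists_mem_boundedRegion f z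
    exact mem_iUnion.2 ⟨n, hz, hn⟩
  have hB' : {z | b < lagrangian Q f z ∧ 0 < f z} ⊆ ⋃ p : ℕ × ℕ,
      ({z | b < lagrangian Q f z} ∩ {z | 1 / ((p.2 : ℝ) + 1) < f z}) ∩ boundedRegion f p.1 :=
    fun z hz => by
      obtain ⟨n, hn⟩ := exists_mem_boundedRegion f z
      obtain ⟨m, hm⟩ := exists_nat_one_div_lt hz.2
      exact mem_iUnion.2 ⟨(n, m), ⟨hz.1, hm⟩, hn⟩
  obtain ⟨m, hm⟩ : ∃ m : ℕ, volume ({z | lagrangian Q f z < a} ∩ boundedRegion f m) ≠ 0 := by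
    by_contra! h
    exact hA (measure_mono_null hA' (measure_iUnion_null h))
  obtain ⟨p, hp⟩ : ∃ p : ℕ × ℕ, volume (({z | b < lagrangian Q f z} ∩
      {z | 1 / ((p.2 : ℝ) + 1) < f z}) ∩ boundedRegion f p.1) ≠ 0 := by
    by_contra! h
    exact hB (measure_mono_null hB' (measure_iUnion_null h))
  refine false_of_exchange hQ hf hfm hf0 hmin hab (n := max (m : ℝ) p.1)
    (δ₀ := 1 / ((p.2 : ℝ) + 1)) (by positivity)
    ((measurableSet_lt hGm measurable_const).inter (measurableSet_boundedRegion hfm _))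
    (((measurableSet_lt measurable_const hGm).inter (measurableSet_lt measurable_const hfm)).inter
      (measurableSet_boundedRegion hfm _))
    (fun z hz => boundedRegion_mono f (le_max_left _ _) hz.2)
    (fun z hz => boundedRegion_mono f (le_max_right _ _) hz.2)
    (fun z hz => hz.1) (fun z hz => hz.1.1) (fun z hz => hz.1.2) hm hp fun R hR => ?_
  filter_upwards [symmetric_lagrangian (Q := Q) hf.2 hR] with z hz
  simp only [mem_inter_iff, mem_ofPred_eq, hz.1, hz.2.1, hz.2.2, and_self]

/-- The Euler-Lagrange equation: a minimizer is a function of the particle energy. -/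
theorem exists_ae_eq_qInv (hQ : CasimirAssumptions Q μ₁ μ₂ μ₃ C₁ C₂ C₃ C₄ F₀) (hM : 0 < M)
    {f : Plane × Plane → ℝ} (hf : f ∈ admissibleSymm Q M) (hfm : Measurable f)
    (hf0 : ∀ z, 0 ≤ f z) (hmin : IsMinOn (energyCasimir Q) (admissibleSymm Q M) f) :
    ∃ E : ℝ, ∀ᵐ z : Plane × Plane,
      f z = qInv Q (E - potential (density f) z.1 - ‖z.2‖ ^ 2 / 2) := by
  have hex := fun {a b : ℝ} (hab : a < b) =>
    measure_lagrangian_lt_eq_zero_or hQ hf hfm hf0 hmin hab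
  have hpos : volume {z | 0 < f z} ≠ 0 := by
    intro h
    have h1 : f =ᵐ[volume] 0 := by
      filter_upwards [measure_eq_zero_iff_ae_notMem.1 h] with z hz
      exact le_antisymm (not_lt.1 hz) (hf0 z)
    have h2 := hf.1.2.2.1
    rw [integral_congr_ae h1] at h2
    simp at h2
    linarith
  obtain ⟨T, hT⟩ : ∃ T : Set ℝ, T = {a | volume {z | lagrangian Q f z < a} = 0} := ⟨_, rfl⟩
  have hTne : T.Nonempty := by
    obtain ⟨n, hn⟩ : ∃ n : ℕ, volume {z | -(n : ℝ) < lagrangian Q f z ∧ 0 < f z} ≠ 0 := by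
      by_contra! h
      refine hpos (measure_mono_null (fun z hz => ?_) (measure_iUnion_null h))
      obtain ⟨n, hn⟩ := exists_nat_gt (-lagrangian Q f z)
      exact mem_iUnion.2 ⟨n, by linarith, hz⟩
    exact ⟨-(n : ℝ) - 1, hT ▸ (hex (by linarith)).resolve_right hn⟩
  have hTbdd : BddAbove T := by
    obtain ⟨n, hn⟩ : ∃ n : ℕ, volume {z | lagrangian Q f z < n} ≠ 0 := by
      by_contra! h
      refine hpos (measure_mono_null (fun z _ => ?_) (measure_iUnion_null h))
      obtain ⟨n, hn⟩ := exists_nat_gt (lagrangian Q f z)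
      exact mem_iUnion.2 ⟨n, hn⟩
    refine ⟨n, fun a ha => ?_⟩
    rw [hT] at ha
    by_contra! h
    exact hn (measure_mono_null (fun z (hz : _ < _) => hz.trans h) ha)
  have hge : ∀ᵐ z, sSup T ≤ lagrangian Q f z := by
    have : volume (⋃ n : ℕ, {z | lagrangian Q f z < sSup T - 1 / ((n : ℝ) + 1)}) = 0 := by
      refine measure_iUnion_null fun n => ?_
      have h0 : 0 < 1 / ((n : ℝ) + 1) := by positivity
      obtain ⟨a, ha, hlt⟩ := exists_lt_of_lt_csSup hTne
        (by linarith : sSup T - 1 / ((n : ℝ) + 1) < sSup T)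
      rw [hT] at ha
      exact measure_mono_null (fun z (hz : _ < _) => hz.trans hlt) ha
    filter_upwards [measure_eq_zero_iff_ae_notMem.1 this] with z hz
    by_contra! h
    obtain ⟨n, hn⟩ := exists_nat_one_div_lt (sub_pos.2 h)
    exact hz (mem_iUnion.2 ⟨n, by rw [mem_ofPred_eq]; linarith⟩)
  have hle : ∀ᵐ z, 0 < f z → lagrangian Q f z ≤ sSup T := by
    have : volume (⋃ n : ℕ, {z | sSup T + 1 / ((n : ℝ) + 1) < lagrangian Q f z ∧ 0 < f z}) = 0 := by
      refine measure_iUnion_null fun n => ?_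
      have h0 : 0 < 1 / ((n : ℝ) + 1) := by positivity
      refine (hex (a := sSup T + 1 / ((n : ℝ) + 1) / 2) (by linarith)).resolve_left fun h => ?_
      have h1 : sSup T + 1 / ((n : ℝ) + 1) / 2 ∈ T := (Set.ext_iff.1 hT _).2 h
      linarith [le_csSup hTbdd h1]
    filter_upwards [measure_eq_zero_iff_ae_notMem.1 this] with z hz hfz
    by_contra! h
    obtain ⟨n, hn⟩ := exists_nat_one_div_lt (sub_pos.2 h)
    exact hz (mem_iUnion.2 ⟨n, by linarith, hfz⟩)
  refine ⟨sSup T, ?_⟩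
  filter_upwards [hge, hle] with z h1 h2
  rcases (hf0 z).eq_or_lt with h0 | h0
  · rw [lagrangian, ← h0, hQ.Q4.2] at h1
    rw [hQ.qInv_of_nonpos (by linarith), h0]
  · have h3 := le_antisymm h1 (h2 h0)
    rw [h3, lagrangian]
    have e : dQ Q (f z) + ‖z.2‖ ^ 2 / 2 + potential (density f) z.1 - potential (density f) z.1
        - ‖z.2‖ ^ 2 / 2 = dQ Q (f z) := by ring
    rw [e, hQ.qInv_dQ h0.le]

/-- The density of a minimizer is a function of its potential. -/
theorem exists_density_ae_eq (hQ : CasimirAssumptions Q μ₁ μ₂ μ₃ C₁ C₂ C₃ C₄ F₀)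
    (hQ' : ∃ C : ℝ, 0 < C ∧ ∀ᶠ f in atTop, C * f ^ (1 / μ₁) ≤ dQ Q f) (hM : 0 < M)
    {f : Plane × Plane → ℝ} (hf : f ∈ admissibleSymm Q M) (hfm : Measurable f)
    (hf0 : ∀ z, 0 ≤ f z) (hmin : IsMinOn (energyCasimir Q) (admissibleSymm Q M) f) :
    ∃ E : ℝ, density f =ᵐ[volume]
      fun x => 2 * Real.pi * qPrim Q (E - potential (density f) x) := by
  obtain ⟨E, hE⟩ := exists_ae_eq_qInv hQ hM hf hfm hf0 hmin
  refine ⟨E, ?_⟩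
  filter_upwards [Measure.ae_ae_of_ae_prod hE] with x hx
  rw [density, integral_congr_ae hx, hQ.integral_qInv hQ']

end EulerLagrange

/-! ### Boundedness of the density -/

section Boundedness

open scoped ENNReal

theorem ennreal_rpow_mul_rpow_le_add (a b : ℝ≥0∞) {p q : ℝ} (hp : 0 ≤ p) (hq : 0 ≤ q) :
    a ^ p * b ^ q ≤ a ^ (p + q) + b ^ (p + q) := by
  rcases le_total a b with h | h
  · refine le_add_left ?_
    rw [ENNReal.rpow_add_of_nonneg _ _ hp hq]
    gcongr
  · refine le_add_right ?_
    rw [ENNReal.rpow_add_of_nonneg _ _ hp hq]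
    gcongr

theorem ennreal_add_sq_le (a b : ℝ≥0∞) : (a + b) ^ 2 ≤ 4 * (a ^ 2 + b ^ 2) := by
  have key : ∀ {a b : ℝ≥0∞}, a ≤ b → (a + b) ^ 2 ≤ 4 * b ^ 2 := fun {a b} h =>
    calc (a + b) ^ 2 ≤ (b + b) ^ 2 := by gcongr
      _ = 4 * b ^ 2 := by ring
  rcases le_total a b with h | h
  · exact (key h).trans (by gcongr; exact le_add_self)
  · rw [add_comm a b]
    exact (key h).trans (by gcongr; exact le_self_add)

theorem lintegral_nearKernel_rpow_lt_top {s : ℝ} (hs0 : 0 < s) (hs : s < 2) :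
    ∫⁻ z, ENNReal.ofReal (nearKernel z) ^ s < ⊤ := by
  have h := (integrable_nearKernel_rpow hs0 hs).lintegral_lt_top
  simpa only [ENNReal.ofReal_rpow_of_nonneg (nearKernel_nonneg _) hs0.le] using h

/-- If `r ∈ L^{3/2}` is bounded by the square of its convolution with the singular kernel `k`, then
this convolution is bounded. The square is estimated by the Cauchy-Schwarz inequality with weights
that leave a factor `k ^ (5 / 6)`, whose convolution with `k` is bounded as `5 / 6 + 1 < 2`. -/
theorem exists_convolution_le {r : Plane → ℝ≥0∞} (hr : Measurable r)
    (hr32 : ∫⁻ y, r y ^ (3 / 2 : ℝ) < ⊤) {D : ℝ≥0∞} (hD : D ≠ ⊤)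
    (hle : ∀ᵐ y, r y ≤ D * (1 + (∫⁻ z, r z * ENNReal.ofReal (nearKernel (y - z))) ^ 2)) :
    ∃ S : ℝ≥0∞, S ≠ ⊤ ∧ ∀ x, ∫⁻ y, r y * ENNReal.ofReal (nearKernel (x - y)) ≤ S := by
  obtain ⟨k, hk⟩ : ∃ k : Plane → ℝ≥0∞, k = fun z => ENNReal.ofReal (nearKernel z) := ⟨_, rfl⟩
  have hkm : Measurable k := by rw [hk]; exact measurable_nearKernel.ennreal_ofReal
  have hkint : ∀ {s : ℝ}, 0 < s → s < 2 → ∫⁻ z, k z ^ s < ⊤ := fun hs0 hs => by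
    rw [hk]; exact lintegral_nearKernel_rpow_lt_top hs0 hs
  have hk1 : ∀ x y, ENNReal.ofReal (nearKernel (x - y)) = k (x - y) := fun x y => by rw [hk]
  simp only [hk1] at hle ⊢
  obtain ⟨R, hR⟩ : ∃ R, R = ∫⁻ y, r y ^ (3 / 2 : ℝ) := ⟨_, rfl⟩
  obtain ⟨S₁, hS₁⟩ : ∃ S, S = R + ∫⁻ z, k z ^ (7 / 4 : ℝ) := ⟨_, rfl⟩
  have hRt : R ≠ ⊤ := by rw [hR]; exact hr32.ne
  have hS₁t : S₁ ≠ ⊤ := by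
    rw [hS₁]; exact ENNReal.add_ne_top.2 ⟨hRt, (hkint (by norm_num) (by norm_num)).ne⟩
  have hksub : ∀ x, Measurable fun y => k (x - y) := fun x =>
    hkm.comp (measurable_const.sub measurable_id)
  have hsq : ∀ x, (∫⁻ z, r z * k (x - z)) ^ 2
      ≤ S₁ * ∫⁻ z, r z ^ (3 / 2 : ℝ) * k (x - z) ^ (5 / 6 : ℝ) := by
    intro x
    have hcs := ENNReal.lintegral_mul_le_Lp_mul_Lq (μ := (volume : Measure Plane))
      Real.HolderConjugate.two_two
      (f := fun z => r z ^ (3 / 4 : ℝ) * k (x - z) ^ (5 / 12 : ℝ))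
      (g := fun z => r z ^ (1 / 4 : ℝ) * k (x - z) ^ (7 / 12 : ℝ))
      ((hr.pow_const _).mul ((hksub x).pow_const _)).aemeasurable
      ((hr.pow_const _).mul ((hksub x).pow_const _)).aemeasurable
    have e1 : ∀ z, ((fun z => r z ^ (3 / 4 : ℝ) * k (x - z) ^ (5 / 12 : ℝ)) *
        fun z => r z ^ (1 / 4 : ℝ) * k (x - z) ^ (7 / 12 : ℝ)) z = r z * k (x - z) := fun z => by
      simp only [Pi.mul_apply]
      rw [mul_mul_mul_comm, ← ENNReal.rpow_add_of_nonneg _ _ (by norm_num) (by norm_num),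
        ← ENNReal.rpow_add_of_nonneg _ _ (by norm_num) (by norm_num)]
      norm_num
    have e2 : ∀ z, (r z ^ (3 / 4 : ℝ) * k (x - z) ^ (5 / 12 : ℝ)) ^ (2 : ℝ)
        = r z ^ (3 / 2 : ℝ) * k (x - z) ^ (5 / 6 : ℝ) := fun z => by
      rw [ENNReal.mul_rpow_of_nonneg _ _ zero_le_two, ← ENNReal.rpow_mul, ← ENNReal.rpow_mul]
      norm_num
    have e3 : ∀ z, (r z ^ (1 / 4 : ℝ) * k (x - z) ^ (7 / 12 : ℝ)) ^ (2 : ℝ)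
        = (r z ^ (3 / 2 : ℝ)) ^ (1 / 3 : ℝ) * (k (x - z) ^ (7 / 4 : ℝ)) ^ (2 / 3 : ℝ) := fun z => by
      rw [ENNReal.mul_rpow_of_nonneg _ _ zero_le_two, ← ENNReal.rpow_mul, ← ENNReal.rpow_mul,
        ← ENNReal.rpow_mul, ← ENNReal.rpow_mul]
      norm_num
    simp only [e1, e2, e3] at hcs
    have hS : ∫⁻ z, (r z ^ (3 / 2 : ℝ)) ^ (1 / 3 : ℝ) * (k (x - z) ^ (7 / 4 : ℝ)) ^ (2 / 3 : ℝ)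
        ≤ S₁ := by
      calc _ ≤ ∫⁻ z, (r z ^ (3 / 2 : ℝ) + k (x - z) ^ (7 / 4 : ℝ)) := by
            refine lintegral_mono fun z => ?_
            refine (ennreal_rpow_mul_rpow_le_add _ _ (by norm_num) (by norm_num)).trans_eq ?_
            norm_num
        _ = S₁ := by
            rw [lintegral_add_left (hr.pow_const _),
              lintegral_sub_left_eq_self (fun z => k z ^ (7 / 4 : ℝ)) x, hS₁, hR]
    calc (∫⁻ z, r z * k (x - z)) ^ 2
        ≤ ((∫⁻ z, r z ^ (3 / 2 : ℝ) * k (x - z) ^ (5 / 6 : ℝ)) ^ (1 / 2 : ℝ) *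
          (∫⁻ z, (r z ^ (3 / 2 : ℝ)) ^ (1 / 3 : ℝ) *
            (k (x - z) ^ (7 / 4 : ℝ)) ^ (2 / 3 : ℝ)) ^ (1 / 2 : ℝ)) ^ 2 := by gcongr
      _ = (∫⁻ z, r z ^ (3 / 2 : ℝ) * k (x - z) ^ (5 / 6 : ℝ)) *
          ∫⁻ z, (r z ^ (3 / 2 : ℝ)) ^ (1 / 3 : ℝ) * (k (x - z) ^ (7 / 4 : ℝ)) ^ (2 / 3 : ℝ) := by
          rw [mul_pow, ← ENNReal.rpow_natCast, ← ENNReal.rpow_natCast, ← ENNReal.rpow_mul,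
            ← ENNReal.rpow_mul]
          norm_num
      _ ≤ S₁ * ∫⁻ z, r z ^ (3 / 2 : ℝ) * k (x - z) ^ (5 / 6 : ℝ) := by
          rw [mul_comm]
          gcongr
  obtain ⟨K, hK⟩ : ∃ K, K = ∫⁻ z, k z ^ (11 / 6 : ℝ) := ⟨_, rfl⟩
  have hKt : K ≠ ⊤ := by rw [hK]; exact (hkint (by norm_num) (by norm_num)).ne
  have hkk : ∀ x z, ∫⁻ y, k (y - z) ^ (5 / 6 : ℝ) * k (x - y) ≤ K + K := by
    intro x z
    have hm : Measurable fun y => k (y - z) ^ (11 / 6 : ℝ) :=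
      (hkm.comp (measurable_id.sub measurable_const)).pow_const _
    calc ∫⁻ y, k (y - z) ^ (5 / 6 : ℝ) * k (x - y)
        ≤ ∫⁻ y, (k (y - z) ^ (11 / 6 : ℝ) + k (x - y) ^ (11 / 6 : ℝ)) := by
          refine lintegral_mono fun y => ?_
          have := ennreal_rpow_mul_rpow_le_add (k (y - z)) (k (x - y)) (p := 5 / 6) (q := 1)
            (by norm_num) zero_le_one
          rw [ENNReal.rpow_one] at this
          refine this.trans_eq ?_
          norm_num
      _ = K + K := by
          rw [lintegral_add_left hm, lintegral_sub_left_eq_self (fun z => k z ^ (11 / 6 : ℝ)) x,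
            lintegral_sub_right_eq_self (fun z => k z ^ (11 / 6 : ℝ)) z, hK]
  obtain ⟨K₁, hK₁⟩ : ∃ K, K = ∫⁻ z, k z := ⟨_, rfl⟩
  have hK₁t : K₁ ≠ ⊤ := by
    have := (hkint one_pos one_lt_two).ne
    simpa only [ENNReal.rpow_one, ← hK₁] using this
  refine ⟨D * (K₁ + S₁ * (R * (K + K))), ?_, fun x => ?_⟩
  · exact ENNReal.mul_ne_top hD (ENNReal.add_ne_top.2 ⟨hK₁t, ENNReal.mul_ne_top hS₁t
      (ENNReal.mul_ne_top hRt (ENNReal.add_ne_top.2 ⟨hKt, hKt⟩))⟩)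
  have hjoint : Measurable fun p : Plane × Plane =>
      r p.2 ^ (3 / 2 : ℝ) * k (p.1 - p.2) ^ (5 / 6 : ℝ) * k (x - p.1) :=
    (((hr.comp measurable_snd).pow_const _).mul
      ((hkm.comp (measurable_fst.sub measurable_snd)).pow_const _)).mul
      (hkm.comp (measurable_const.sub measurable_fst))
  have hdouble : ∫⁻ y, (∫⁻ z, r z ^ (3 / 2 : ℝ) * k (y - z) ^ (5 / 6 : ℝ)) * k (x - y)
      ≤ R * (K + K) := by
    calc ∫⁻ y, (∫⁻ z, r z ^ (3 / 2 : ℝ) * k (y - z) ^ (5 / 6 : ℝ)) * k (x - y)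
        = ∫⁻ y, ∫⁻ z, r z ^ (3 / 2 : ℝ) * k (y - z) ^ (5 / 6 : ℝ) * k (x - y) := by
          refine lintegral_congr fun y => ?_
          rw [lintegral_mul_const]
          exact (hr.pow_const _).mul ((hksub y).pow_const _)
      _ = ∫⁻ z, ∫⁻ y, r z ^ (3 / 2 : ℝ) * k (y - z) ^ (5 / 6 : ℝ) * k (x - y) :=
          lintegral_lintegral_swap hjoint.aemeasurable
      _ = ∫⁻ z, r z ^ (3 / 2 : ℝ) * ∫⁻ y, k (y - z) ^ (5 / 6 : ℝ) * k (x - y) := by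
          refine lintegral_congr fun z => ?_
          rw [← lintegral_const_mul]
          · simp_rw [mul_assoc]
          · exact ((hkm.comp (measurable_id.sub measurable_const)).pow_const _).mul (hksub x)
      _ ≤ ∫⁻ z, r z ^ (3 / 2 : ℝ) * (K + K) := by
          refine lintegral_mono fun z => ?_
          gcongr
          exact hkk x z
      _ = R * (K + K) := by rw [lintegral_mul_const _ (hr.pow_const _), hR]
  calc ∫⁻ y, r y * k (x - y)
      ≤ ∫⁻ y, D * (k (x - y)
          + S₁ * ((∫⁻ z, r z ^ (3 / 2 : ℝ) * k (y - z) ^ (5 / 6 : ℝ)) * k (x - y))) := by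
        refine lintegral_mono_ae ?_
        filter_upwards [hle] with y hy
        calc r y * k (x - y) ≤ D * (1 + (∫⁻ z, r z * k (y - z)) ^ 2) * k (x - y) := by gcongr
          _ ≤ D * (1 + S₁ * ∫⁻ z, r z ^ (3 / 2 : ℝ) * k (y - z) ^ (5 / 6 : ℝ)) * k (x - y) := by
              gcongr
              exact hsq y
          _ = _ := by ring
    _ = D * (K₁ + S₁ * ∫⁻ y, (∫⁻ z, r z ^ (3 / 2 : ℝ) * k (y - z) ^ (5 / 6 : ℝ)) * k (x - y)) := by
        rw [lintegral_const_mul' _ _ hD, lintegral_add_left (hksub x),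
          lintegral_const_mul' _ _ hS₁t, lintegral_sub_left_eq_self k x, hK₁]
    _ ≤ D * (K₁ + S₁ * (R * (K + K))) := by gcongr

theorem lintegral_enorm_div_le (ρ : Plane → ℝ) (hρ : Measurable ρ) (x : Plane) :
    ∫⁻ y, ‖ρ y / ‖x - y‖‖ₑ
      ≤ (∫⁻ y, ‖ρ y‖ₑ * ENNReal.ofReal (nearKernel (x - y))) + ∫⁻ y, ‖ρ y‖ₑ := by
  rw [← lintegral_add_right _ hρ.enorm]
  refine lintegral_mono fun y => ?_
  rw [div_eq_mul_one_div, enorm_mul, Real.enorm_of_nonneg (by positivity : 0 ≤ 1 / ‖x - y‖)]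
  calc ‖ρ y‖ₑ * ENNReal.ofReal (1 / ‖x - y‖)
      ≤ ‖ρ y‖ₑ * ENNReal.ofReal (nearKernel (x - y) + 1) := by
        gcongr
        exact one_div_norm_le _
    _ = ‖ρ y‖ₑ * ENNReal.ofReal (nearKernel (x - y)) + ‖ρ y‖ₑ := by
        rw [ENNReal.ofReal_add (nearKernel_nonneg _) zero_le_one, ENNReal.ofReal_one, mul_add,
          mul_one]

/-- A density in `L¹ ∩ L^{3/2}` that is bounded quadratically in terms of its potential is bounded,
and its potential converges everywhere. -/
theorem bounded_of_le_potential_sq {ρ : Plane → ℝ} (hρm : Measurable ρ) (hρ : IsTame ρ)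
    {A E : ℝ} (hA : 0 ≤ A) (hle : ∀ᵐ x, |ρ x| ≤ A * (1 + (E - potential ρ x) ^ 2)) :
    (∃ B, 0 ≤ B ∧ ∀ᵐ x, |ρ x| ≤ B) ∧ ∀ x, Integrable fun y => ρ y / ‖x - y‖ := by
  obtain ⟨N, hN⟩ : ∃ N : Plane → ℝ≥0∞,
      N = fun x => ∫⁻ y, ‖ρ y‖ₑ * ENNReal.ofReal (nearKernel (x - y)) := ⟨_, rfl⟩
  obtain ⟨m, hm⟩ : ∃ m : ℝ≥0∞, m = ∫⁻ y, ‖ρ y‖ₑ := ⟨_, rfl⟩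
  have hmt : m ≠ ⊤ := by rw [hm]; exact hρ.1.2.ne
  have hdiv : ∀ x, ∫⁻ y, ‖ρ y / ‖x - y‖‖ₑ ≤ N x + m := fun x => by
    rw [hN, hm]; exact lintegral_enorm_div_le ρ hρm x
  have hU : ∀ x, ‖potential ρ x‖ₑ ≤ N x + m := fun x => by
    rw [potential, enorm_neg]
    exact (enorm_integral_le_lintegral_enorm _).trans (hdiv x)
  obtain ⟨c, hc⟩ : ∃ c : ℝ≥0∞, c = ‖E‖ₑ + m := ⟨_, rfl⟩
  have hct : c ≠ ⊤ := by rw [hc]; exact ENNReal.add_ne_top.2 ⟨enorm_ne_top, hmt⟩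
  obtain ⟨D, hD⟩ : ∃ D, D = ENNReal.ofReal A * (4 * (1 + c ^ 2)) := ⟨_, rfl⟩
  have hDt : D ≠ ⊤ := by
    rw [hD]
    exact ENNReal.mul_ne_top ENNReal.ofReal_ne_top (ENNReal.mul_ne_top (by norm_num)
      (ENNReal.add_ne_top.2 ⟨ENNReal.one_ne_top, ENNReal.pow_ne_top hct⟩))
  have hr : ∀ᵐ x, ‖ρ x‖ₑ ≤ D * (1 + N x ^ 2) := by
    filter_upwards [hle] with x hx
    have h1 : ‖E - potential ρ x‖ₑ ≤ N x + c := by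
      calc ‖E - potential ρ x‖ₑ ≤ ‖E‖ₑ + ‖potential ρ x‖ₑ := enorm_sub_le
        _ ≤ ‖E‖ₑ + (N x + m) := by gcongr; exact hU x
        _ = N x + c := by rw [hc]; ring
    calc ‖ρ x‖ₑ = ENNReal.ofReal |ρ x| := by rw [← ofReal_norm, Real.norm_eq_abs]
      _ ≤ ENNReal.ofReal (A * (1 + (E - potential ρ x) ^ 2)) := ENNReal.ofReal_le_ofReal hx
      _ = ENNReal.ofReal A * (1 + ‖E - potential ρ x‖ₑ ^ 2) := by
          rw [ENNReal.ofReal_mul hA, ENNReal.ofReal_add zero_le_one (sq_nonneg _),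
            ENNReal.ofReal_one, ← ofReal_norm, ← ENNReal.ofReal_pow (norm_nonneg _),
            Real.norm_eq_abs, sq_abs]
      _ ≤ ENNReal.ofReal A * (1 + 4 * (N x ^ 2 + c ^ 2)) := by
          gcongr
          exact (pow_le_pow_left₀ zero_le h1 2).trans (ennreal_add_sq_le _ _)
      _ ≤ ENNReal.ofReal A * (4 * (1 + c ^ 2) * (1 + N x ^ 2)) := by
          gcongr
          have e : 4 * (1 + c ^ 2) * (1 + N x ^ 2)
              = (1 + 4 * (N x ^ 2 + c ^ 2)) + (3 + 4 * (c ^ 2 * N x ^ 2)) := by ring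
          rw [e]
          exact le_self_add
      _ = D * (1 + N x ^ 2) := by rw [hD]; ring
  have h32 : ∫⁻ y, ‖ρ y‖ₑ ^ (3 / 2 : ℝ) < ⊤ := by
    have h := hρ.2.lintegral_lt_top
    refine lt_of_le_of_lt (le_of_eq (lintegral_congr fun y => ?_)) h
    rw [← ofReal_norm, Real.norm_eq_abs, ENNReal.ofReal_rpow_of_nonneg (abs_nonneg _)
      (by norm_num)]
  rw [hN] at hr
  obtain ⟨S, hS, hNS⟩ := exists_convolution_le hρm.enorm h32 hDt hr
  have hNS' : ∀ x, N x ≤ S := fun x => by rw [hN]; exact hNS x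
  have hTt : D * (1 + S ^ 2) ≠ ⊤ := ENNReal.mul_ne_top hDt
    (ENNReal.add_ne_top.2 ⟨ENNReal.one_ne_top, ENNReal.pow_ne_top hS⟩)
  refine ⟨⟨(D * (1 + S ^ 2)).toReal, ENNReal.toReal_nonneg, ?_⟩, fun x => ⟨?_, ?_⟩⟩
  · filter_upwards [hr] with x hx
    have h1 : ‖ρ x‖ₑ ≤ D * (1 + S ^ 2) := hx.trans (by gcongr; exact hNS x)
    have h2 := (ENNReal.toReal_le_toReal enorm_ne_top hTt).2 h1
    rwa [toReal_enorm, Real.norm_eq_abs] at h2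
  · exact (hρm.div (measurable_const.sub measurable_id).norm).aestronglyMeasurable
  · exact (hdiv x).trans_lt (ENNReal.add_lt_top.2
      ⟨(hNS' x).trans_lt hS.lt_top, hmt.lt_top⟩)

end Boundedness

/-! ### Measurable representatives and conclusion -/

section Representative

variable {Q : ℝ → ℝ} {M : ℝ} {f g : Plane × Plane → ℝ}

theorem density_ae_eq (h : f =ᵐ[volume] g) : density f =ᵐ[volume] density g := by
  filter_upwards [Measure.ae_ae_of_ae_prod h] with x hx
  exact integral_congr_ae hx

theorem potential_congr_ae {ρ σ : Plane → ℝ} (h : ρ =ᵐ[volume] σ) : potential ρ = potential σ := by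
  funext x
  rw [potential, potential]
  congr 1
  refine integral_congr_ae ?_
  filter_upwards [h] with y hy
  rw [hy]

theorem energyCasimir_congr_ae (h : f =ᵐ[volume] g) : energyCasimir Q f = energyCasimir Q g := by
  have h1 : casimir Q f = casimir Q g := integral_congr_ae (by
    filter_upwards [h] with z hz
    rw [hz])
  have h2 : kineticEnergy f = kineticEnergy g := by
    rw [kineticEnergy, kineticEnergy]
    congr 1
    refine integral_congr_ae ?_
    filter_upwards [h] with z hz
    rw [hz]
  have h3 : potentialEnergy f = potentialEnergy g := by
    rw [potentialEnergy, potentialEnergy, potential_congr_ae (density_ae_eq h)]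
    congr 1
    refine integral_congr_ae ?_
    filter_upwards [density_ae_eq h] with x hx
    rw [hx]
  rw [energyCasimir, energyCasimir, h1, h2, h3]

theorem mem_admissibleSymm_congr_ae (h : f =ᵐ[volume] g) (hf : f ∈ admissibleSymm Q M) :
    g ∈ admissibleSymm Q M := by
  obtain ⟨⟨h1, h2, h3, h4, h5⟩, h6⟩ := hf
  refine ⟨⟨h1.congr h, ?_, ?_, ?_, ?_⟩, fun R hR => ?_⟩
  · filter_upwards [h, h2] with z hz hz'
    rwa [← hz]
  · rw [← h3]
    exact integral_congr_ae h.symm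
  · refine h4.congr ?_
    filter_upwards [h] with z hz
    rw [hz]
  · refine h5.congr ?_
    filter_upwards [h] with z hz
    rw [hz]
  · obtain ⟨L, hL⟩ := exists_linearIsometryEquiv_of_mem_specialOrthogonalGroup hR
    have hmp : MeasurePreserving (Prod.map L L) (volume : Measure (Plane × Plane)) volume :=
      L.measurePreserving.prod L.measurePreserving
    filter_upwards [h, h6 R hR, hmp.quasiMeasurePreserving.ae h] with z hz hz1 hz2
    rw [← hz, ← hz1, ← hL, ← hL]
    exact hz2.symm

/-- An admissible function has a measurable representative that is nonnegative everywhere. -/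
theorem exists_measurable_nonneg_ae_eq (hf : f ∈ admissible Q M) :
    ∃ g : Plane × Plane → ℝ, Measurable g ∧ (∀ z, 0 ≤ g z) ∧ f =ᵐ[volume] g := by
  refine ⟨fun z => max 0 (hf.1.1.mk f z), ?_, fun z => le_max_left _ _, ?_⟩
  · exact measurable_const.max hf.1.1.stronglyMeasurable_mk.measurable
  · filter_upwards [hf.1.1.ae_eq_mk, hf.2.1] with z h1 h2
    rw [← h1, max_eq_right h2]

end Representative

end FlatVlasovPoisson

theorem theorem3 (Q : ℝ → ℝ) (μ₁ μ₂ μ₃ C₁ C₂ C₃ C₄ F₀ : ℝ)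
    (hQ : FlatVlasovPoisson.CasimirAssumptions Q μ₁ μ₂ μ₃ C₁ C₂ C₃ C₄ F₀)
    (hQ' : ∃ C : ℝ, 0 < C ∧ ∀ᶠ f in atTop, C * f ^ (1 / μ₁) ≤ FlatVlasovPoisson.dQ Q f)
    (M : ℝ) (hM : 0 < M)
    (f₀ : FlatVlasovPoisson.Plane × FlatVlasovPoisson.Plane → ℝ)
    (hf₀ : f₀ ∈ FlatVlasovPoisson.admissibleSymm Q M)
    (hmin : IsMinOn (FlatVlasovPoisson.energyCasimir Q)
      (FlatVlasovPoisson.admissibleSymm Q M) f₀)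
    (U₀ : FlatVlasovPoisson.Plane → ℝ)
    (hU₀ : U₀ = FlatVlasovPoisson.potential (FlatVlasovPoisson.density f₀)) :
    -- the density, an element of `L¹`, has a `C¹` representative
    (∃ ρ₀ : FlatVlasovPoisson.Plane → ℝ,
      FlatVlasovPoisson.density f₀ =ᵐ[volume] ρ₀ ∧ ContDiff ℝ 1 ρ₀) ∧
    -- the integral that defines the potential converges at every point
    (∀ x, Integrable fun y => FlatVlasovPoisson.density f₀ y / ‖x - y‖) ∧
    ContDiff ℝ 1 U₀ ∧
    FlatVlasovPoisson.IsHolder (fderiv ℝ U₀) ∧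
    (FlatVlasovPoisson.IsLocallyHolder (FlatVlasovPoisson.qInv Q) →
      ContDiff ℝ 2 U₀ ∧ FlatVlasovPoisson.IsHolder (fderiv ℝ (fderiv ℝ U₀))) := by
  open FlatVlasovPoisson in
  obtain ⟨f, hfm, hf0, hff⟩ := exists_measurable_nonneg_ae_eq hf₀.1
  have hf : f ∈ admissibleSymm Q M := mem_admissibleSymm_congr_ae hff hf₀
  have hfmin : IsMinOn (energyCasimir Q) (admissibleSymm Q M) f := fun g hg => by
    have h := hmin hg
    rwa [mem_ofPred_eq, energyCasimir_congr_ae hff] at h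
  have hρρ := density_ae_eq hff
  rw [hU₀, potential_congr_ae hρρ]
  obtain ⟨E, hE⟩ := exists_density_ae_eq hQ hQ' hM hf hfm hf0 hfmin
  have hρ : IsTame (density f) := isTame_density_of_mem_admissible hQ hf.1
  have hρm : Measurable (density f) :=
    (hfm.stronglyMeasurable.integral_prod_right' (ν := volume)).measurable
  have hρ0 : ∀ x, 0 ≤ density f x := fun x => integral_nonneg fun v => hf0 _
  obtain ⟨A, hA, hPA⟩ := hQ.exists_qPrim_le hQ'
  have hle : ∀ᵐ x, |density f x|
      ≤ 2 * Real.pi * A * (1 + (E - potential (density f) x) ^ 2) := by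
    filter_upwards [hE] with x hx
    rw [abs_of_nonneg (hρ0 x), hx, mul_assoc _ A]
    exact mul_le_mul_of_nonneg_left (hPA _) Real.two_pi_pos.le
  obtain ⟨⟨B, hB0, hB⟩, hconv⟩ := bounded_of_le_potential_sq hρm hρ
    (mul_nonneg Real.two_pi_pos.le hA.le) hle
  obtain ⟨h1, h2, h3, h4⟩ := regularity_of_eq_comp_potential hρ.1 hB0 hB
    (hQ.hasDerivAt_qPrim hQ') (hQ.continuous_qInv hQ') (2 * Real.pi) E hE
  refine ⟨⟨_, hρρ.trans hE, h1⟩, fun x => (hconv x).congr ?_, h2, h3, h4⟩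
  filter_upwards [hρρ] with y hy
  rw [hy]
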